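/- There is an absolute constant $c > 0$ such that the following holds for all integers $r, k \ge 3$. If $G$ is a finite simple graph with chromatic number $k$ that contains no complete subgraph $K_{r+1}$, then $G$ contains a cycle of length at least $c\,k^{r/(r-1)}$, and there are integers $a \ge 3$ and $m \ge c\,k^{r/(r-1)}$ such that $G$ contains a cycle of each of the $m$ consecutive lengths $a, a+1, \dots, a+m-1$. -/

import Mathlib

namespace SimpleGraph

/-- `G` contains a cycle of length `l` (number of edges, equivalently number of vertices). -/
def HasCycleOfLength {V : Type*} (G : SimpleGraph V) (l : ℕ) : Prop :=
  ∃ (v : V) (p : G.Walk v v), p.IsCycle ∧ p.length = l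

/-- `G` contains cycles of `m` consecutive lengths `a, a + 1, …, a + m - 1`. -/
def HasCyclesOfConsecutiveLengths {V : Type*} (G : SimpleGraph V) (m : ℕ) : Prop :=
  ∃ a : ℕ, ∀ i : ℕ, i < m → G.HasCycleOfLength (a + i)

end SimpleGraph

/-! The cycles come from a long path inside one distance layer: its initial segments are closed up
through a breadth-first tree by detours of one fixed length.

Pass to a critical (minimal non-colourable, hence connected) set and root it. Adjacent vertices lie
in equal or consecutive layers, so some layer keeps half of the chromatic number; let `D` be a
critical set in it. Going up the tree to the first height `j` where all of `D` has a common ancestor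
splits `D` into `A` and `B` so that every `a ∈ A`, `b ∈ B` are joined by a tree path of length
exactly `2 * j` that meets `D` only in its ends (`exists_split_of_dist_eq`). One part, say `A`,
still has large chromatic number. A long path in `A` yields, as `D` is connected, a path at least
half as long that starts in `B` and never returns there. Its initial segments grow by one edge at a
time and close to cycles of consecutive lengths (`hasCyclesOfConsecutiveLengths_of_path`).

For the long path, `exists_linkedOn_of_not_colorableOn` finds `H ⊆ A` of large chromatic number
without separations of order below `s ≈ √q`, where `q` is of order `k`. Let `P` be a longest path in
`H`. If `P` itself is not `q`-colourable, a Ramsey-type colouring bound makes it long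
(`rpow_le_card_of_not_colorableOn`). Otherwise `H \ P` contains a cycle longer than `q`, and
Menger's theorem supplies `s` disjoint paths from `P` to it. Rerouting `P` through the cycle cannot
lengthen it, so the feet of these paths are about `q / 2` apart and `P` has length of order `q ^ (3
/ 2)`, which suffices because `r / (r - 1) ≤ 3 / 2` for `r ≥ 3` (`LinkedOn.exists_long_path`). -/

namespace SimpleGraph

open scoped Classical

variable {V : Type*} {G G' : SimpleGraph V}

/-! ### Colourings of vertex sets and critical sets -/

/-- The subgraph of `G` induced on the finset `S` has a proper colouring with `n` colours. -/
def ColorableOn (G : SimpleGraph V) (S : Finset V) (n : ℕ) : Prop :=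
  ∃ c : V → ℕ, (∀ v ∈ S, c v < n) ∧ ∀ u ∈ S, ∀ v ∈ S, G.Adj u v → c u ≠ c v

theorem ColorableOn.mono {S T : Finset V} {m n : ℕ} (h : G.ColorableOn T m) (hST : S ⊆ T)
    (hmn : m ≤ n) : G.ColorableOn S n := by
  obtain ⟨c, hc, hp⟩ := h
  exact ⟨c, fun v hv => (hc v (hST hv)).trans_le hmn,
    fun u hu v hv => hp u (hST hu) v (hST hv)⟩

theorem ColorableOn.union {S T : Finset V} {m n : ℕ} (hS : G.ColorableOn S m)
    (hT : G.ColorableOn T n) : G.ColorableOn (S ∪ T) (m + n) := by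
  obtain ⟨c, hc, hp⟩ := hS
  obtain ⟨d, hd, hq⟩ := hT
  refine ⟨fun v => if v ∈ S then c v else m + d v, fun v hv => ?_, fun u hu v hv huv => ?_⟩
  · by_cases h : v ∈ S
    · have := hc v h
      simp only [h, if_true]; omega
    · have := hd v ((Finset.mem_union.1 hv).resolve_left h)
      simp only [h, if_false]; omega
  · by_cases hu' : u ∈ S <;> by_cases hv' : v ∈ S <;> simp only [hu', hv', if_true, if_false]
    · exact hp u hu' v hv' huv
    · have := hc u hu'; omega
    · have := hc v hv'; omega
    · have := hq u ((Finset.mem_union.1 hu).resolve_left hu') v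
        ((Finset.mem_union.1 hv).resolve_left hv') huv
      omega

theorem colorableOn_one_of_independent {S : Finset V}
    (h : ∀ u ∈ S, ∀ v ∈ S, ¬ G.Adj u v) : G.ColorableOn S 1 :=
  ⟨fun _ => 0, fun _ _ => one_pos, fun u hu v hv huv => (h u hu v hv huv).elim⟩

theorem colorableOn_empty (n : ℕ) : G.ColorableOn ∅ n :=
  ⟨fun _ => 0, by simp, by simp⟩

theorem colorableOn_card (S : Finset V) : G.ColorableOn S S.card := by
  induction S using Finset.induction_on with
  | empty => exact colorableOn_empty _
  | insert a S ha ih =>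
    rw [Finset.card_insert_of_notMem ha, Finset.insert_eq, add_comm]
    refine ColorableOn.union (colorableOn_one_of_independent ?_) ih
    intro u hu v hv huv
    rw [Finset.mem_singleton] at hu hv
    exact huv.ne (hu.trans hv.symm)

/-- A vertex with fewer than `n` neighbours in a set does not affect `n`-colourability. -/
theorem ColorableOn.of_erase {S : Finset V} {n : ℕ} {v : V}
    (h : G.ColorableOn (S.erase v) n) (hd : (S.filter (G.Adj v)).card < n) :
    G.ColorableOn S n := by
  obtain ⟨c, hc, hp⟩ := h
  obtain ⟨a, ha, ha'⟩ : ∃ a ∈ Finset.range n, a ∉ (S.filter (G.Adj v)).image c := by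
    apply Finset.exists_mem_notMem_of_card_lt_card
    rw [Finset.card_range]
    exact Finset.card_image_le.trans_lt hd
  have key : ∀ u ∈ S, G.Adj v u → c u ≠ a := fun u hu hvu hcu =>
    ha' (Finset.mem_image.2 ⟨u, Finset.mem_filter.2 ⟨hu, hvu⟩, hcu⟩)
  refine ⟨fun u => if u = v then a else c u, fun u hu => ?_, fun u hu w hw huw => ?_⟩
  · by_cases huv : u = v
    · simpa [huv] using ha
    · simpa [huv] using hc u (Finset.mem_erase.2 ⟨huv, hu⟩)
  · by_cases h1 : u = v <;> by_cases h2 : w = v <;> simp only [h1, h2, if_true, if_false]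
    · exact (huw.ne (h1.trans h2.symm)).elim
    · exact (key w hw (h1 ▸ huw)).symm
    · exact key u hu (h2 ▸ huw.symm)
    · exact hp u (Finset.mem_erase.2 ⟨h1, hu⟩) w (Finset.mem_erase.2 ⟨h2, hw⟩) huw

/-- A set that is inclusion-minimal among those that are not `n`-colourable. -/
def CriticalOn (G : SimpleGraph V) (S : Finset V) (n : ℕ) : Prop :=
  ¬ G.ColorableOn S n ∧ ∀ T, T ⊂ S → G.ColorableOn T n

theorem exists_criticalOn_subset {S : Finset V} {n : ℕ} (h : ¬ G.ColorableOn S n) :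
    ∃ T ⊆ S, G.CriticalOn T n := by
  induction S using Finset.strongInduction with
  | H S ih =>
    by_cases hT : ∃ T, T ⊂ S ∧ ¬ G.ColorableOn T n
    · obtain ⟨T, hTS, hT⟩ := hT
      obtain ⟨U, hU, hU'⟩ := ih T hTS hT
      exact ⟨U, hU.trans hTS.subset, hU'⟩
    · push Not at hT
      exact ⟨S, subset_rfl, h, hT⟩

/-- With fewer neighbours, `v` would have a free colour in any colouring of the rest. This is the
source of all minimum degree bounds below. -/
theorem CriticalOn.le_card_filter_adj {S : Finset V} {n : ℕ} (h : G.CriticalOn S n) {v : V}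
    (hv : v ∈ S) : n ≤ (S.filter (G.Adj v)).card := by
  by_contra hlt
  exact h.1 ((h.2 _ (Finset.erase_ssubset hv)).of_erase (not_le.1 hlt))

theorem CriticalOn.nonempty {S : Finset V} {n : ℕ} (h : G.CriticalOn S n) : S.Nonempty := by
  rw [Finset.nonempty_iff_ne_empty]
  rintro rfl
  exact h.1 (colorableOn_empty n)

/-- A critical set cannot be split into two nonempty parts without edges between them. -/
theorem CriticalOn.exists_adj {S : Finset V} {n : ℕ} (h : G.CriticalOn S n) {T : Finset V}
    (hTS : T ⊆ S) (hT : T.Nonempty) (hT' : T ≠ S) : ∃ u ∈ T, ∃ v ∈ S \ T, G.Adj u v := by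
  by_contra hno
  push Not at hno
  obtain ⟨c, hc, hp⟩ := h.2 T (hTS.ssubset_of_ne hT')
  obtain ⟨d, hd, hq⟩ := h.2 (S \ T) (Finset.sdiff_ssubset hTS hT)
  refine h.1 ⟨fun v => if v ∈ T then c v else d v, fun v hv => ?_, fun u hu v hv huv => ?_⟩
  · by_cases hvT : v ∈ T
    · simpa [hvT] using hc v hvT
    · simpa [hvT] using hd v (Finset.mem_sdiff.2 ⟨hv, hvT⟩)
  · by_cases hu' : u ∈ T <;> by_cases hv' : v ∈ T <;> simp only [hu', hv', if_true, if_false]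
    · exact hp u hu' v hv' huv
    · exact (hno u hu' v (Finset.mem_sdiff.2 ⟨hv, hv'⟩) huv).elim
    · exact (hno v hv' u (Finset.mem_sdiff.2 ⟨hu, hu'⟩) huv.symm).elim
    · exact hq u (Finset.mem_sdiff.2 ⟨hu, hu'⟩) v (Finset.mem_sdiff.2 ⟨hv, hv'⟩) huv

/-- Any two vertices of a critical set are joined by a walk inside it. -/
theorem CriticalOn.exists_walk {S : Finset V} {n : ℕ} (h : G.CriticalOn S n) {u v : V}
    (hu : u ∈ S) (hv : v ∈ S) : ∃ p : G.Walk u v, ∀ x ∈ p.support, x ∈ S := by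
  set T := S.filter (fun w => ∃ p : G.Walk u w, ∀ x ∈ p.support, x ∈ S) with hT
  by_cases hTS : T = S
  · rw [← hTS] at hv
    exact (Finset.mem_filter.1 hv).2
  · have huT : u ∈ T := Finset.mem_filter.2 ⟨hu, Walk.nil, by simpa using hu⟩
    obtain ⟨a, ha, b, hb, hab⟩ := h.exists_adj (Finset.filter_subset _ _) ⟨u, huT⟩ hTS
    obtain ⟨hbS, hbT⟩ := Finset.mem_sdiff.1 hb
    obtain ⟨p, hp⟩ := (Finset.mem_filter.1 ha).2
    refine (hbT (Finset.mem_filter.2 ⟨hbS, p.concat hab, fun x hx => ?_⟩)).elim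
    rw [Walk.support_concat, List.mem_append, List.mem_singleton] at hx
    rcases hx with hx | rfl
    · exact hp x hx
    · exact hbS

theorem colorableOn_univ_iff [Fintype V] {n : ℕ} :
    G.ColorableOn Finset.univ n ↔ G.Colorable n := by
  constructor
  · rintro ⟨c, hc, hp⟩
    exact ⟨Coloring.mk (fun v => (⟨c v, hc v (Finset.mem_univ v)⟩ : Fin n)) fun {u v} huv heq =>
      hp u (Finset.mem_univ u) v (Finset.mem_univ v) huv (congrArg Fin.val heq)⟩
  · rintro ⟨C⟩
    exact ⟨fun v => (C v : ℕ), fun v _ => (C v).2, fun u _ v _ huv heq =>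
      C.valid huv (Fin.ext heq)⟩

/-! ### Few vertices and small cliques force few colours -/

/-- A greedy independent set in a set of vertices of bounded degree. -/
theorem exists_independent_of_degree_lt {d : ℕ} (hd' : 0 < d) (j : ℕ) (S : Finset V)
    (hd : ∀ v ∈ S, (S.filter (G.Adj v)).card < d) (hS : j * d ≤ S.card) :
    ∃ I ⊆ S, I.card = j ∧ ∀ u ∈ I, ∀ v ∈ I, ¬ G.Adj u v := by
  induction j generalizing S with
  | zero => exact ⟨∅, by simp, by simp, by simp⟩
  | succ j ih =>
    rcases S.eq_empty_or_nonempty with rfl | ⟨v, hv⟩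
    · simp [hd'.ne'] at hS
    · have hlt := hd v hv
      set T := (S.erase v) \ S.filter (G.Adj v) with hT
      have hTS : T ⊆ S := Finset.sdiff_subset.trans (Finset.erase_subset _ _)
      obtain ⟨I, hI, hIc, hIi⟩ := ih T
        (fun w hw => (Finset.card_le_card (Finset.filter_subset_filter _ hTS)).trans_lt
          (hd w (hTS hw)))
        (by
          have h1 := Finset.le_card_sdiff (S.filter (G.Adj v)) (S.erase v)
          have h2 := Finset.card_erase_add_one hv
          rw [← hT] at h1
          rw [add_mul] at hS
          omega)
      have hvI : v ∉ I := fun h => by simpa [hT] using hI h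
      have hvadj : ∀ w ∈ I, ¬ G.Adj v w := fun w hw hvw =>
        (Finset.mem_sdiff.1 (hI hw)).2 (Finset.mem_filter.2 ⟨hTS (hI hw), hvw⟩)
      refine ⟨insert v I, Finset.insert_subset hv (hI.trans hTS),
        by rw [Finset.card_insert_of_notMem hvI, hIc], ?_⟩
      intro a ha b hb hab
      rcases Finset.mem_insert.1 ha with rfl | ha' <;> rcases Finset.mem_insert.1 hb with rfl | hb'
      · exact hab.ne rfl
      · exact hvadj b hb' hab
      · exact hvadj a ha' hab.symm
      · exact hIi a ha' b hb' hab

/-- Ramsey bound: a set of `t ^ r` vertices without a clique on `r + 1` vertices contains an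
independent set of size `t`. -/
theorem exists_independent_of_cliqueFree {t : ℕ} (r : ℕ) (S : Finset V) (hr : 1 ≤ r)
    (hcl : ∀ T ⊆ S, G.IsClique T → T.card ≤ r) (hS : t ^ r ≤ S.card) :
    ∃ I ⊆ S, I.card = t ∧ ∀ u ∈ I, ∀ v ∈ I, ¬ G.Adj u v := by
  induction r, hr using Nat.le_induction generalizing S with
  | base =>
    rw [pow_one] at hS
    obtain ⟨I, hI, hIc⟩ := Finset.exists_subset_card_eq hS
    refine ⟨I, hI, hIc, fun u hu v hv huv => ?_⟩
    have h := hcl {u, v} (by simp [Finset.insert_subset_iff, hI hu, hI hv])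
      (by simp [isClique_iff, Set.pairwise_insert, huv, huv.symm])
    rw [Finset.card_pair huv.ne] at h
    omega
  | succ r hr ih =>
    rcases Nat.eq_zero_or_pos t with rfl | ht
    · exact ⟨∅, by simp, by simp, by simp⟩
    -- Small degrees allow a greedy choice among `t * t ^ r` vertices; a vertex of large degree has
    -- a neighbourhood in which cliques are smaller by one.
    by_cases hd : ∀ v ∈ S, (S.filter (G.Adj v)).card < t ^ r
    · exact exists_independent_of_degree_lt (Nat.pow_pos ht) t S hd (by rw [pow_succ] at hS; linarith)
    · push Not at hd
      obtain ⟨v, hv, hd⟩ := hd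
      obtain ⟨I, hI, hIc, hIi⟩ := ih (S.filter (G.Adj v)) (fun T hT hTc => by
        have hvT : v ∉ T := fun h => by simpa using hT h
        have h := hcl (insert v T)
          (Finset.insert_subset hv (hT.trans (Finset.filter_subset _ _))) (by
            rw [Finset.coe_insert]
            exact hTc.insert fun w hw _ => (Finset.mem_filter.1 (hT hw)).2)
        rw [Finset.card_insert_of_notMem hvT] at h
        omega) hd
      exact ⟨I, hI.trans (Finset.filter_subset _ _), hIc, hIi⟩

/-- As long as more than `t ^ r` vertices remain, the Ramsey bound gives an independent set of size
`t`, which is removed as one colour class. -/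
theorem colorableOn_of_card_le_add {t r : ℕ} {n : ℕ} (hr : 1 ≤ r)
    (hcl : G.CliqueFree (r + 1))
    (hbase : ∀ S : Finset V, S.card ≤ t ^ r → G.ColorableOn S n) (j : ℕ) (S : Finset V)
    (hS : S.card ≤ t ^ r + j * t) : G.ColorableOn S (n + j) := by
  induction j generalizing S with
  | zero => exact hbase S (by simpa using hS)
  | succ j ih =>
    by_cases hlt : S.card ≤ t ^ r
    · exact (hbase S hlt).mono subset_rfl (by omega)
    · obtain ⟨I, hI, hIc, hIi⟩ := exists_independent_of_cliqueFree (G := G) (t := t) r S hr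
        (fun T _ hT => by
          by_contra hcon
          obtain ⟨U, hU, hUc⟩ := Finset.exists_subset_card_eq (not_le.1 hcon)
          exact hcl U ⟨hT.subset (by exact_mod_cast hU), hUc⟩) (by omega)
      have h1 := ih (S \ I) (by
        have := Finset.card_sdiff_add_card_eq_card hI
        rw [add_mul] at hS; omega)
      have h2 := h1.union (colorableOn_one_of_independent hIi)
      rw [Finset.sdiff_union_of_subset hI] at h2
      exact h2

/-- Induction on `t`: with `x = (t + 1) ^ (r - 1) - t ^ (r - 1)`, removing `3 * x` independent sets
of size `t` leads from `(t + 1) ^ r` vertices down to `t ^ r`, since `(t + 1) ^ r ≤ t ^ r + 3 * x *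
t`. -/
theorem colorableOn_of_card_le_pow {r : ℕ} (hr : 2 ≤ r) (hcl : G.CliqueFree (r + 1)) {t : ℕ}
    (ht : 1 ≤ t) (S : Finset V) (hS : S.card ≤ t ^ r) : G.ColorableOn S (3 * t ^ (r - 1)) := by
  induction t, ht using Nat.le_induction generalizing S with
  | base => exact (colorableOn_card S).mono subset_rfl (by simpa using hS.trans (by simp))
  | succ t ht ih =>
    obtain ⟨a, rfl⟩ : ∃ a, r = a + 2 := ⟨r - 2, by omega⟩
    simp only [Nat.add_succ_sub_one] at ih ⊢
    obtain ⟨x, hx⟩ : ∃ x, (t + 1) ^ (a + 1) = t ^ (a + 1) + x :=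
      ⟨_, (Nat.add_sub_of_le (Nat.pow_le_pow_left (Nat.le_succ t) _)).symm⟩
    have hxa : t ^ a ≤ x := by
      have h1 : t ^ a ≤ (t + 1) ^ a := Nat.pow_le_pow_left (Nat.le_succ t) _
      rw [pow_succ, pow_succ] at hx
      nlinarith
    have h := colorableOn_of_card_le_add (by omega) hcl ih (3 * x) S (hS.trans (by
      have h1 : (t + 1) ^ (a + 2) = (t + 1) ^ (a + 1) * (t + 1) := pow_succ _ _
      have h2 : t ^ (a + 2) = t ^ (a + 1) * t := pow_succ _ _
      have h3 : t ^ (a + 1) = t ^ a * t := pow_succ _ _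
      rw [h1, h2, hx]
      nlinarith [Nat.mul_le_mul_right t hxa, Nat.mul_le_mul_left x ht]))
    exact h.mono subset_rfl (by rw [hx]; omega)

/-- In a `K_{r+1}`-free graph, a set that is not `q`-colourable has at least
`(q / 3) ^ (r / (r - 1)) / 2` vertices. -/
theorem rpow_le_card_of_not_colorableOn {r : ℕ} (hr : 2 ≤ r) (hcl : G.CliqueFree (r + 1))
    {q : ℕ} (hq : 3 ≤ q) {S : Finset V} (hS : ¬ G.ColorableOn S q) :
    ((q : ℝ) / 3) ^ ((r : ℝ) / ((r : ℝ) - 1)) / 2 ≤ (S.card : ℝ) := by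
  obtain ⟨a, rfl⟩ : ∃ a, r = a + 2 := ⟨r - 2, by omega⟩
  have hfin : {t : ℕ | 3 * t ^ (a + 1) ≤ q}.Finite := by
    refine (Set.finite_le_nat q).subset fun t ht => ?_
    have h1 : t ≤ t ^ (a + 1) := Nat.le_self_pow (by omega) t
    have h2 : 3 * t ^ (a + 1) ≤ q := ht
    show t ≤ q
    omega
  -- The largest `t` for which sets of `t ^ r` vertices are within the budget of `q` colours; the
  -- unspent colours each absorb `t` further vertices. Maximality gives `t + 1 ≥ (q / 3) ^ (1 / (r -
  -- 1))`, and `t + 1 ≤ 2 * t` costs the final factor `2`.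
  obtain ⟨t, ht, hmax⟩ := hfin.exists_maximal ⟨1, by simpa using hq⟩
  have ht3 : 3 * t ^ (a + 1) ≤ q := ht
  have ht1 : 1 ≤ t := by
    by_contra h0
    have h1 := hmax (show (1 : ℕ) ∈ {t : ℕ | 3 * t ^ (a + 1) ≤ q} by simpa using hq) (by omega)
    omega
  have hlt : q < 3 * (t + 1) ^ (a + 1) := by
    by_contra hge
    have := hmax (show t + 1 ∈ {t : ℕ | 3 * t ^ (a + 1) ≤ q} from not_lt.1 hge) (by omega)
    omega
  have hcard : t ^ (a + 2) + (q - 3 * t ^ (a + 1)) * t < S.card := by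
    by_contra hle
    apply hS
    have h := colorableOn_of_card_le_add (by omega) hcl
      (colorableOn_of_card_le_pow hr hcl ht1) (q - 3 * t ^ (a + 1)) S (not_lt.1 hle)
    exact h.mono subset_rfl (by simp only [Nat.add_succ_sub_one]; omega)
  have hcard' : (q : ℝ) / 3 * t ≤ S.card := by
    obtain ⟨j, hj⟩ : ∃ j, q = 3 * t ^ (a + 1) + j := ⟨_, (Nat.add_sub_of_le ht3).symm⟩
    rw [hj, Nat.add_sub_cancel_left, pow_succ] at hcard
    have h1 : ((t ^ (a + 1) * t + j * t : ℕ) : ℝ) < S.card := by exact_mod_cast hcard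
    rw [hj]
    push_cast at h1 ⊢
    have : (0 : ℝ) ≤ j * t := by positivity
    nlinarith
  have hq0 : (0 : ℝ) < (q : ℝ) / 3 := by positivity
  have hroot : ((q : ℝ) / 3) ^ ((1 : ℝ) / (a + 1)) ≤ t + 1 := by
    have h1 : (q : ℝ) / 3 ≤ ((t : ℝ) + 1) ^ (a + 1) := by
      have : (q : ℝ) < 3 * ((t : ℝ) + 1) ^ (a + 1) := by exact_mod_cast hlt
      linarith
    calc ((q : ℝ) / 3) ^ ((1 : ℝ) / (a + 1))
        ≤ (((t : ℝ) + 1) ^ (a + 1)) ^ ((1 : ℝ) / (a + 1)) := by gcongr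
      _ = t + 1 := by
        rw [← Real.rpow_natCast, ← Real.rpow_mul (by positivity)]
        push_cast
        rw [mul_one_div_cancel (by positivity), Real.rpow_one]
  have hexp : (((a + 2 : ℕ) : ℝ) / (((a + 2 : ℕ) : ℝ) - 1)) = 1 + 1 / ((a : ℝ) + 1) := by
    push_cast
    have : (a : ℝ) + 1 ≠ 0 := by positivity
    have h2 : (a : ℝ) + 2 - 1 = a + 1 := by ring
    rw [h2]
    field_simp
    ring
  rw [hexp, Real.rpow_add hq0, Real.rpow_one]
  have h1t : (1 : ℝ) ≤ t := by exact_mod_cast ht1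
  calc (q : ℝ) / 3 * ((q : ℝ) / 3) ^ ((1 : ℝ) / (a + 1)) / 2
      ≤ (q : ℝ) / 3 * (t + t) / 2 := by gcongr; linarith
    _ = (q : ℝ) / 3 * t := by ring
    _ ≤ S.card := hcard'

/-! ### Highly linked subsets of large chromatic number -/

/-- The subgraph of `G` induced on `H` has no separation of order less than `s`. -/
def LinkedOn (G : SimpleGraph V) (H : Finset V) (s : ℕ) : Prop :=
  ∀ A B : Finset V, A ∪ B = H → (A ∩ B).card < s →
    (∀ a ∈ A \ B, ∀ b ∈ B \ A, ¬ G.Adj a b) → A ⊆ B ∨ B ⊆ A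

/-- If all linked subsets are `c`-colourable, then a partial colouring extends to the whole set,
avoiding prescribed forbidden colours, provided that these constraints are few. -/
theorem exists_coloring_extension {s c : ℕ} (hs : 1 ≤ s) (W : Finset V)
    (hW : ∀ H ⊆ W, G.LinkedOn H s → G.ColorableOn H c) (S : Finset V) (hSW : S ⊆ W)
    (pre : V → ℕ) (F : V → Finset ℕ) (hpre : ∀ v ∈ S, pre v < c + 2 * s ^ 2)
    (hprop : ∀ u ∈ S, ∀ v ∈ S, G.Adj u v → pre u ≠ pre v)
    (hμ : s * S.card + ∑ x ∈ W \ S, (F x).card ≤ 2 * s ^ 2) :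
    ∃ col : V → ℕ, (∀ v ∈ W, col v < c + 2 * s ^ 2) ∧
      (∀ u ∈ W, ∀ v ∈ W, G.Adj u v → col u ≠ col v) ∧
      (∀ v ∈ S, col v = pre v) ∧ ∀ x ∈ W \ S, col x ∉ F x := by
  induction W using Finset.strongInduction generalizing S pre F with
  | H W ih =>
  -- A precoloured vertex with at most `s` neighbours outside `S` is deleted and its colour
  -- forbidden there: the weight `s * |S| + ∑ |F x|` loses `s` and gains at most `s`.
  by_cases hlow : ∃ v ∈ S, ((W \ S).filter (G.Adj v)).card ≤ s
  · obtain ⟨v, hv, hlow⟩ := hlow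
    have hdiff : W.erase v \ S.erase v = W \ S := by
      ext x
      simp only [Finset.mem_sdiff, Finset.mem_erase]
      constructor
      · rintro ⟨⟨h1, h2⟩, h3⟩; exact ⟨h2, fun h => h3 ⟨h1, h⟩⟩
      · rintro ⟨h1, h2⟩; exact ⟨⟨fun h => h2 (h ▸ hv), h1⟩, fun h => h2 h.2⟩
    obtain ⟨col, h1, h2, h3, h4⟩ := ih (W.erase v) (Finset.erase_ssubset (hSW hv))
      (fun H hH => hW H (hH.trans (Finset.erase_subset _ _))) (S.erase v)
      (Finset.erase_subset_erase _ hSW) pre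
      (fun x => if G.Adj v x then insert (pre v) (F x) else F x)
      (fun x hx => hpre x (Finset.mem_of_mem_erase hx))
      (fun x hx y hy => hprop x (Finset.mem_of_mem_erase hx) y (Finset.mem_of_mem_erase hy))
      (by
        rw [hdiff]
        have hsum : ∑ x ∈ W \ S, (if G.Adj v x then insert (pre v) (F x) else F x).card ≤
            ∑ x ∈ W \ S, (F x).card + ((W \ S).filter (G.Adj v)).card := by
          rw [Finset.card_filter, ← Finset.sum_add_distrib]
          refine Finset.sum_le_sum fun x _ => ?_
          by_cases hx : G.Adj v x
          · simpa [hx] using Finset.card_insert_le _ _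
          · simp [hx]
        have hc := Finset.card_erase_add_one hv
        have : s * S.card = s * (S.erase v).card + s := by rw [← hc]; ring
        omega)
    rw [hdiff] at h4
    refine ⟨Function.update col v (pre v), fun x hx => ?_, fun x hx y hy hxy => ?_,
      fun x hx => ?_, fun x hx => ?_⟩
    · by_cases hxv : x = v
      · rw [hxv, Function.update_self]; exact hpre v hv
      · rw [Function.update_of_ne hxv]; exact h1 x (Finset.mem_erase.2 ⟨hxv, hx⟩)
    · have key : ∀ x ∈ W, G.Adj v x → pre v ≠ col x := by
        intro x hx hvx heq
        by_cases hxS : x ∈ S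
        · have := h3 x (Finset.mem_erase.2 ⟨hvx.ne', hxS⟩)
          exact hprop v hv x hxS hvx (heq.trans this)
        · have := h4 x (Finset.mem_sdiff.2 ⟨hx, hxS⟩)
          rw [if_pos hvx] at this
          exact this (heq ▸ Finset.mem_insert_self _ _)
      by_cases hxv : x = v
      · have hyv : y ≠ v := fun h => hxy.ne (hxv.trans h.symm)
        rw [hxv, Function.update_self, Function.update_of_ne hyv]
        exact key y hy (hxv ▸ hxy)
      · by_cases hyv : y = v
        · rw [hyv, Function.update_self, Function.update_of_ne hxv]
          exact (key x hx (hyv ▸ hxy.symm)).symm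
        · rw [Function.update_of_ne hxv, Function.update_of_ne hyv]
          exact h2 x (Finset.mem_erase.2 ⟨hxv, hx⟩) y (Finset.mem_erase.2 ⟨hyv, hy⟩) hxy
    · by_cases hxv : x = v
      · rw [hxv, Function.update_self]
      · rw [Function.update_of_ne hxv]; exact h3 x (Finset.mem_erase.2 ⟨hxv, hx⟩)
    · have hxv : x ≠ v := fun h => (Finset.mem_sdiff.1 hx).2 (h ▸ hv)
      rw [Function.update_of_ne hxv]
      intro hF
      apply h4 x hx
      by_cases hvx : G.Adj v x
      · rw [if_pos hvx]; exact Finset.mem_insert_of_mem hF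
      · rwa [if_neg hvx]
  push Not at hlow
  by_cases hlink : G.LinkedOn W s
  · obtain ⟨d, hd, hdp⟩ := hW W subset_rfl hlink
    -- All colours occurring in a constraint. There are at most `2 * s ^ 2` of them, so a
    -- `c`-colouring of `W` can be renamed to avoid them all.
    set U := S.image pre ∪ (W \ S).biUnion F with hU
    have hUc : U.card ≤ 2 * s ^ 2 := by
      refine (Finset.card_union_le _ _).trans (le_trans (add_le_add ?_ Finset.card_biUnion_le) hμ)
      exact Finset.card_image_le.trans (Nat.le_mul_of_pos_left _ hs)
    have hR : c ≤ (Finset.range (c + 2 * s ^ 2) \ U).card := by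
      have := Finset.le_card_sdiff U (Finset.range (c + 2 * s ^ 2))
      rw [Finset.card_range] at this
      omega
    -- The default value `0` is never used, as `d` takes values below `c` on `W`.
    let e : ℕ → ℕ := fun i => if h : i < c then Finset.orderEmbOfCardLe _ hR ⟨i, h⟩ else 0
    have he : ∀ x ∈ W, e (d x) ∈ Finset.range (c + 2 * s ^ 2) \ U := fun x hx => by
      simp only [e, dif_pos (hd x hx)]
      exact Finset.orderEmbOfCardLe_mem _ hR _
    have hinj : ∀ x ∈ W, ∀ y ∈ W, e (d x) = e (d y) → d x = d y := fun x hx y hy h => by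
      simp only [e, dif_pos (hd x hx), dif_pos (hd y hy)] at h
      simpa using h
    have hnot : ∀ x ∈ W, e (d x) ∉ U := fun x hx => (Finset.mem_sdiff.1 (he x hx)).2
    have hne : ∀ x ∈ W, ∀ y ∈ S, e (d x) ≠ pre y := fun x hx y hy h =>
      hnot x hx (h ▸ Finset.mem_union_left _ (Finset.mem_image_of_mem _ hy))
    refine ⟨fun x => if x ∈ S then pre x else e (d x), fun x hx => ?_, fun x hx y hy hxy => ?_,
      fun x hx => if_pos hx, fun x hx => ?_⟩
    · by_cases hxS : x ∈ S
      · simpa only [hxS, if_true] using hpre x hxS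
      · simpa only [hxS, if_false] using Finset.mem_range.1 (Finset.mem_sdiff.1 (he x hx)).1
    · by_cases hxS : x ∈ S <;> by_cases hyS : y ∈ S <;> simp only [hxS, hyS, if_true, if_false]
      · exact hprop x hxS y hyS hxy
      · exact (hne y hy x hxS).symm
      · exact hne x hx y hyS
      · exact fun h => hdp x hx y hy hxy (hinj x hx y hy h)
    · obtain ⟨hxW, hxS⟩ := Finset.mem_sdiff.1 hx
      simp only [hxS, if_false]
      exact fun h => hnot x hxW
        (Finset.mem_union_right _ (Finset.mem_biUnion.2 ⟨x, hx, h⟩))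
  -- Glueing along a separation whose strict side `B \ A` carries at most half of the weight: colour
  -- `A ∪ S` first, then extend to `B`. The overlap contributes at most `s * |A ∩ B| ≤ s ^ 2`, so
  -- the budget is respected again.
  have key : ∀ A B : Finset V, A ∪ B = W → (A ∩ B).card < s →
      (∀ a ∈ A \ B, ∀ b ∈ B \ A, ¬ G.Adj a b) → ¬ A ⊆ B → ¬ B ⊆ A →
      s * ((B \ A) ∩ S).card + ∑ x ∈ (B \ A) \ S, (F x).card ≤ s ^ 2 →
      ∃ col : V → ℕ, (∀ v ∈ W, col v < c + 2 * s ^ 2) ∧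
        (∀ u ∈ W, ∀ v ∈ W, G.Adj u v → col u ≠ col v) ∧
        (∀ v ∈ S, col v = pre v) ∧ ∀ x ∈ W \ S, col x ∉ F x := by
    intro A B hAB hcard hno hA hB hside
    have hAW : A ⊆ W := hAB ▸ Finset.subset_union_left
    have hBW : B ⊆ W := hAB ▸ Finset.subset_union_right
    have hmemW : ∀ x ∈ W, x ∈ A ∨ x ∈ B := fun x hx => Finset.mem_union.1 (hAB ▸ hx)
    -- This makes `A ∪ S` a proper subset of `W`. If `B \ A` lay inside `S`, a vertex there would
    -- have all its neighbours outside `S` in `A ∩ B`, fewer than `s`, against `hlow`.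
    obtain ⟨x₀, hx₀B, hx₀A, hx₀S⟩ : ∃ x ∈ B, x ∉ A ∧ x ∉ S := by
      by_contra! hcon
      obtain ⟨v, hvB, hvA⟩ := Finset.not_subset.1 hB
      have hvS := hcon v hvB hvA
      refine (hlow v hvS).not_ge (le_trans (Finset.card_le_card ?_) hcard.le)
      intro y hy
      obtain ⟨hy1, hvy⟩ := Finset.mem_filter.1 hy
      obtain ⟨hyW, hyS⟩ := Finset.mem_sdiff.1 hy1
      have hyA : y ∈ A := by
        rcases hmemW y hyW with h | h
        · exact h
        · by_contra h'; exact hyS (hcon y h h')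
      refine Finset.mem_inter.2 ⟨hyA, ?_⟩
      by_contra hyB
      exact hno y (Finset.mem_sdiff.2 ⟨hyA, hyB⟩) v (Finset.mem_sdiff.2 ⟨hvB, hvA⟩) hvy.symm
    obtain ⟨x₁, hx₁A, hx₁B⟩ := Finset.not_subset.1 hA
    have hASW : A ∪ S ⊆ W := Finset.union_subset hAW hSW
    obtain ⟨c1, h1, h2, h3, h4⟩ := ih (A ∪ S)
      (Finset.ssubset_iff_subset_ne.2 ⟨hASW, fun h => by
        have := hBW hx₀B
        rw [← h, Finset.mem_union] at this
        tauto⟩)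
      (fun H hH => hW H (hH.trans hASW)) S Finset.subset_union_right pre F hpre hprop
      (le_trans (Nat.add_le_add_left (Finset.sum_le_sum_of_subset
        (Finset.sdiff_subset_sdiff hASW subset_rfl)) _) hμ)
    set S' := B ∩ (A ∪ S) with hS'
    have hS'sub : S' ⊆ A ∪ S := Finset.inter_subset_right
    have hS'c : S'.card ≤ (A ∩ B).card + ((B \ A) ∩ S).card := by
      refine le_trans (Finset.card_le_card ?_) (Finset.card_union_le _ _)
      intro x hx
      simp only [hS', Finset.mem_inter, Finset.mem_union, Finset.mem_sdiff] at hx ⊢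
      tauto
    obtain ⟨c2, g1, g2, g3, g4⟩ := ih B
      (Finset.ssubset_iff_subset_ne.2 ⟨hBW, fun h => hx₁B (h ▸ hAW hx₁A)⟩)
      (fun H hH => hW H (hH.trans hBW)) S' Finset.inter_subset_left c1 F
      (fun x hx => h1 x (hS'sub hx)) (fun x hx y hy => h2 x (hS'sub hx) y (hS'sub hy))
      (by
        have e1 : ∑ x ∈ B \ S', (F x).card ≤ ∑ x ∈ (B \ A) \ S, (F x).card :=
          Finset.sum_le_sum_of_subset fun x hx => by
            simp only [hS', Finset.mem_inter, Finset.mem_union, Finset.mem_sdiff] at hx ⊢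
            tauto
        have e2 : s * S'.card ≤ s * (A ∩ B).card + s * ((B \ A) ∩ S).card := by
          rw [← mul_add]; exact Nat.mul_le_mul_left _ hS'c
        have e3 : s * (A ∩ B).card ≤ s ^ 2 := by
          rw [sq]; exact Nat.mul_le_mul_left _ hcard.le
        omega)
    have hcB : ∀ x ∈ B, (if x ∈ A ∪ S then c1 x else c2 x) = c2 x := fun x hx => by
      by_cases hx' : x ∈ A ∪ S
      · rw [if_pos hx', g3 x (Finset.mem_inter.2 ⟨hx, hx'⟩)]
      · rw [if_neg hx']
    have hcA : ∀ x ∈ A, (if x ∈ A ∪ S then c1 x else c2 x) = c1 x := fun x hx =>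
      if_pos (Finset.mem_union_left _ hx)
    refine ⟨fun x => if x ∈ A ∪ S then c1 x else c2 x, fun x hx => ?_, fun x hx y hy hxy => ?_,
      fun x hx => ?_, fun x hx => ?_⟩
    · dsimp only
      rcases hmemW x hx with h | h
      · rw [hcA x h]; exact h1 x (Finset.mem_union_left _ h)
      · rw [hcB x h]; exact g1 x h
    · dsimp only
      by_cases hxA : x ∈ A <;> by_cases hyA : y ∈ A
      · rw [hcA x hxA, hcA y hyA]
        exact h2 x (Finset.mem_union_left _ hxA) y (Finset.mem_union_left _ hyA) hxy
      · have hyB := (hmemW y hy).resolve_left hyA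
        have hxB : x ∈ B := by
          by_contra hxB
          exact hno x (Finset.mem_sdiff.2 ⟨hxA, hxB⟩) y (Finset.mem_sdiff.2 ⟨hyB, hyA⟩) hxy
        rw [hcB x hxB, hcB y hyB]
        exact g2 x hxB y hyB hxy
      · have hxB := (hmemW x hx).resolve_left hxA
        have hyB : y ∈ B := by
          by_contra hyB
          exact hno y (Finset.mem_sdiff.2 ⟨hyA, hyB⟩) x (Finset.mem_sdiff.2 ⟨hxB, hxA⟩) hxy.symm
        rw [hcB x hxB, hcB y hyB]
        exact g2 x hxB y hyB hxy
      · have hxB := (hmemW x hx).resolve_left hxA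
        have hyB := (hmemW y hy).resolve_left hyA
        rw [hcB x hxB, hcB y hyB]
        exact g2 x hxB y hyB hxy
    · dsimp only
      rw [if_pos (Finset.mem_union_right _ hx)]; exact h3 x hx
    · obtain ⟨hxW, hxS⟩ := Finset.mem_sdiff.1 hx
      dsimp only
      by_cases hxA : x ∈ A
      · rw [hcA x hxA]
        exact h4 x (Finset.mem_sdiff.2 ⟨Finset.mem_union_left _ hxA, hxS⟩)
      · have hxB := (hmemW x hxW).resolve_left hxA
        rw [hcB x hxB]
        refine g4 x (Finset.mem_sdiff.2 ⟨hxB, fun h => ?_⟩)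
        rcases Finset.mem_union.1 (hS'sub h) with h | h
        · exact hxA h
        · exact hxS h
  unfold LinkedOn at hlink
  push Not at hlink
  obtain ⟨A, B, hAB, hcard, hno, hA, hB⟩ := hlink
  -- The strict sides are disjoint, so one of them has weight at most `s ^ 2`.
  have hsplit : (s * ((B \ A) ∩ S).card + ∑ x ∈ (B \ A) \ S, (F x).card) +
      (s * ((A \ B) ∩ S).card + ∑ x ∈ (A \ B) \ S, (F x).card) ≤ 2 * s ^ 2 := by
    have hd : Disjoint (B \ A) (A \ B) := disjoint_sdiff_sdiff
    have e1 : ((B \ A) ∩ S).card + ((A \ B) ∩ S).card ≤ S.card := by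
      rw [← Finset.card_union_of_disjoint
        (hd.mono Finset.inter_subset_left Finset.inter_subset_left)]
      exact Finset.card_le_card (Finset.union_subset Finset.inter_subset_right
        Finset.inter_subset_right)
    have e2 : ∑ x ∈ (B \ A) \ S, (F x).card + ∑ x ∈ (A \ B) \ S, (F x).card ≤
        ∑ x ∈ W \ S, (F x).card := by
      rw [← Finset.sum_union (hd.mono Finset.sdiff_subset Finset.sdiff_subset)]
      refine Finset.sum_le_sum_of_subset fun x hx => ?_
      rw [← hAB]
      simp only [Finset.mem_union, Finset.mem_sdiff] at hx ⊢
      tauto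
    have e3 := Nat.mul_le_mul_left s e1
    rw [mul_add] at e3
    omega
  rcases le_or_gt (s * ((B \ A) ∩ S).card + ∑ x ∈ (B \ A) \ S, (F x).card) (s ^ 2) with h | h
  · exact key A B hAB hcard hno hA hB h
  · exact key B A (by rw [Finset.union_comm, hAB]) (by rwa [Finset.inter_comm])
      (fun b hb a ha hba => hno a ha b hb hba.symm) hB hA (by omega)

/-- A set of large chromatic number contains a well linked set of large chromatic number. -/
theorem exists_linkedOn_of_not_colorableOn {s c : ℕ} (hs : 1 ≤ s) {W : Finset V}
    (hW : ¬ G.ColorableOn W (c + 2 * s ^ 2)) :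
    ∃ H ⊆ W, G.LinkedOn H s ∧ ¬ G.ColorableOn H c := by
  by_contra! hcon
  obtain ⟨col, h1, h2, -, -⟩ := exists_coloring_extension hs W hcon ∅ (by simp) (fun _ => 0)
    (fun _ => ∅) (by simp) (by simp) (by simp)
  exact hW ⟨col, h1, h2⟩

/-! ### Menger's theorem -/

/-- Every walk from `X` to `Y` meets `T`. -/
def Separates (G : SimpleGraph V) (X Y T : Finset V) : Prop :=
  ∀ x ∈ X, ∀ y ∈ Y, ∀ p : G.Walk x y, ∃ v ∈ p.support, v ∈ T

/-- There are `n` pairwise disjoint paths from `X` to `Y`. -/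
def HasLinkage (G : SimpleGraph V) (X Y : Finset V) (n : ℕ) : Prop :=
  ∃ (a b : Fin n → V) (p : ∀ i, G.Walk (a i) (b i)), (∀ i, a i ∈ X) ∧ (∀ i, b i ∈ Y) ∧
    (∀ i, (p i).IsPath) ∧ ∀ i j, i ≠ j → ∀ v ∈ (p i).support, v ∉ (p j).support

/-- `v` can be reached from `X` by a walk that avoids `S`. -/
def ReachableAvoiding (G : SimpleGraph V) (X S : Finset V) (v : V) : Prop :=
  ∃ a ∈ X, ∃ p : G.Walk a v, ∀ u ∈ p.support, u ∉ S

theorem Separates.symm {X Y T : Finset V} (h : G.Separates X Y T) : G.Separates Y X T :=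
  fun y hy x hx p => by simpa using h x hx y hy p.reverse

theorem ReachableAvoiding.of_mem {X S : Finset V} {v : V} (hv : v ∈ X) (hS : v ∉ S) :
    G.ReachableAvoiding X S v :=
  ⟨v, hv, Walk.nil, by simpa using hS⟩

theorem ReachableAvoiding.not_mem {X S : Finset V} {v : V} (h : G.ReachableAvoiding X S v) :
    v ∉ S := by
  obtain ⟨a, -, p, hp⟩ := h
  exact hp v p.end_mem_support

theorem ReachableAvoiding.adj {X S : Finset V} {u v : V} (h : G.ReachableAvoiding X S u)
    (huv : G.Adj u v) (hv : v ∉ S) : G.ReachableAvoiding X S v := by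
  obtain ⟨a, ha, p, hp⟩ := h
  refine ⟨a, ha, p.concat huv, fun x hx => ?_⟩
  rw [Walk.support_concat, List.mem_append, List.mem_singleton] at hx
  rcases hx with hx | rfl
  · exact hp x hx
  · exact hv

theorem Separates.not_reachableAvoiding {X Y S : Finset V} (h : G.Separates X Y S) {v : V}
    (hX : G.ReachableAvoiding X S v) : ¬ G.ReachableAvoiding Y S v := by
  rintro ⟨b, hb, q, hq⟩
  obtain ⟨a, ha, p, hp⟩ := hX
  obtain ⟨u, hu, huS⟩ := h a ha b hb (p.append q.reverse)
  rw [Walk.mem_support_append_iff, Walk.support_reverse, List.mem_reverse] at hu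
  exact hu.elim (fun h => hp u h huS) (fun h => hq u h huS)

theorem hasLinkage_of_walks {X Y : Finset V} {n : ℕ} (a b : Fin n → V)
    (p : ∀ i, G.Walk (a i) (b i)) (ha : ∀ i, a i ∈ X) (hb : ∀ i, b i ∈ Y)
    (hd : ∀ i j, i ≠ j → ∀ v ∈ (p i).support, v ∉ (p j).support) : G.HasLinkage X Y n :=
  ⟨a, b, fun i => (p i).bypass, ha, hb, fun i => (p i).bypass_isPath, fun i j hij v hv hv' =>
    hd i j hij v ((p i).support_bypass_subset_support hv) ((p j).support_bypass_subset_support hv')⟩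

/-- A walk avoiding `T` must leave the part that `G'` can reach from `X` before it meets `insert x
S`, hence along the extra edge. Leaving from `x` contradicts the choice of `T`; leaving from `y`
would make `y` reachable while avoiding `S` too, because every vertex of `S` is cut off by `T`. -/
theorem Separates.of_separates_insert {X Y S T : Finset V} {x y : V}
    (hadj : ∀ u v, G.Adj u v → G'.Adj u v ∨ (u = x ∧ v = y) ∨ (u = y ∧ v = x))
    (hy : ¬ G'.ReachableAvoiding X S y) (hS : G.Separates X Y (insert x S))
    (hT : G'.Separates X (insert x S) T) : G.Separates X Y T := by
  intro a ha b hb p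
  by_contra! hcon
  have hZ : ∀ z ∈ insert x S, ¬ G'.ReachableAvoiding X T z := by
    rintro z hz ⟨a', ha', q, hq⟩
    obtain ⟨v, hv, hvT⟩ := hT a' ha' z hz q
    exact hq v hv hvT
  obtain ⟨z, hz, hzS⟩ := hS a ha b hb p
  have hza : z ∈ (p.takeUntil z hz).support := Walk.end_mem_support _
  obtain ⟨d, hd, hd1, hd2⟩ := (p.takeUntil z hz).exists_boundary_dart
    {v | G'.ReachableAvoiding X T v} (ReachableAvoiding.of_mem ha (hcon a p.start_mem_support))
    (hZ z hzS)
  have hdT : d.snd ∉ T := hcon _ (p.support_takeUntil_subset_support hz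
    (Walk.dart_snd_mem_support_of_mem_darts _ hd))
  rcases hadj _ _ d.adj with h | ⟨h, -⟩ | ⟨h, -⟩
  · exact hd2 (hd1.adj h hdT)
  · exact hZ x (Finset.mem_insert_self _ _) (h ▸ hd1)
  · rw [Set.mem_ofPred_eq, h] at hd1
    obtain ⟨a', ha', q, hq⟩ := hd1
    refine hy ⟨a', ha', q, fun u hu huS => hZ u (Finset.mem_insert_of_mem huS)
      ⟨a', ha', q.takeUntil u hu, fun w hw => hq w (q.support_takeUntil_subset_support hu hw)⟩⟩

/-- Along a linkage of size `n` ending in a set `Z` of size `n`, each path meets `Z` only in its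
endpoint, and every vertex of `Z` is an endpoint. -/
theorem linkage_endpoints {n : ℕ} {Z : Finset V} (hZ : Z.card = n) {a z : Fin n → V}
    (p : ∀ i, G.Walk (a i) (z i)) (hz : ∀ i, z i ∈ Z)
    (hd : ∀ i j, i ≠ j → ∀ v ∈ (p i).support, v ∉ (p j).support) :
    Function.Injective z ∧ (∀ v ∈ Z, ∃ i, z i = v) ∧
      ∀ i, ∀ v ∈ (p i).support, v ∈ Z → v = z i := by
  have hinj : Function.Injective z := fun i j hij => by
    by_contra hne
    exact hd i j hne _ (p i).end_mem_support (by rw [hij]; exact (p j).end_mem_support)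
  have hsurj : ∀ v ∈ Z, ∃ i, z i = v := by
    have : Finset.univ.image z = Z := by
      apply Finset.eq_of_subset_of_card_le
      · intro v hv
        obtain ⟨i, -, rfl⟩ := Finset.mem_image.1 hv
        exact hz i
      · rw [Finset.card_image_of_injective _ hinj, hZ]; simp
    intro v hv
    rw [← this] at hv
    obtain ⟨i, -, hi⟩ := Finset.mem_image.1 hv
    exact ⟨i, hi⟩
  refine ⟨hinj, hsurj, fun i v hv hvZ => ?_⟩
  obtain ⟨j, rfl⟩ := hsurj v hvZ
  by_contra hne
  exact hd i j (fun h => hne (by rw [h])) _ hv (p j).end_mem_support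

theorem reachableAvoiding_of_mem_path {X S : Finset V} {a z v : V} (ha : a ∈ X)
    (p : G.Walk a z) (hp : p.IsPath) (hS : ∀ u ∈ p.support, u ∈ S → u = z)
    (hv : v ∈ p.support) (hvS : v ∉ S) : G.ReachableAvoiding X S v := by
  refine ⟨a, ha, p.takeUntil v hv, fun u hu huS => ?_⟩
  have huz := hS u (p.support_takeUntil_subset_support hv hu) huS
  subst huz
  exact Walk.endpoint_notMem_support_takeUntil hp hv (fun h => hvS (h ▸ huS)) hu

/-- By cardinality the two linkages use every vertex of `insert x S` and `insert y S` as an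
endpoint. Paths ending at the same vertex of `S` are joined there, and those ending at `x` and `y`
by the edge. Since `S` separates in `G'`, paths from different sides meet only in `S`. -/
theorem HasLinkage.glue {X Y S : Finset V} {n : ℕ} {x y : V} (hle : G' ≤ G) (hxy : G.Adj x y)
    (hxS : x ∉ S) (hyS : y ∉ S) (hn : S.card + 1 = n) (hsep : G'.Separates X Y S)
    (hX : G'.HasLinkage X (insert x S) n) (hY : G'.HasLinkage Y (insert y S) n) :
    G.HasLinkage X Y n := by
  obtain ⟨a, z, p, ha, hz, hp, hpd⟩ := hX
  obtain ⟨b, w, q, hb, hw, hq, hqd⟩ := hY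
  obtain ⟨hzinj, hzsurj, hzend⟩ := linkage_endpoints
    (by rw [Finset.card_insert_of_notMem hxS, hn]) p hz hpd
  obtain ⟨hwinj, hwsurj, hwend⟩ := linkage_endpoints
    (by rw [Finset.card_insert_of_notMem hyS, hn]) q hw hqd
  have hmeet : ∀ i j v, v ∈ (p i).support → v ∈ (q j).support → v ∈ S := by
    intro i j v hv hv'
    by_contra hvS
    exact hsep.not_reachableAvoiding
      (reachableAvoiding_of_mem_path (ha i) (p i) (hp i)
        (fun u hu huS => hzend i u hu (Finset.mem_insert_of_mem huS)) hv hvS)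
      (reachableAvoiding_of_mem_path (hb j) (q j) (hq j)
        (fun u hu huS => hwend j u hu (Finset.mem_insert_of_mem huS)) hv' hvS)
  have hex : ∀ i, ∃ j, (z i ∈ S ∧ w j = z i) ∨ (z i = x ∧ w j = y) := by
    intro i
    rcases Finset.mem_insert.1 (hz i) with h | h
    · obtain ⟨j, hj⟩ := hwsurj y (Finset.mem_insert_self _ _)
      exact ⟨j, Or.inr ⟨h, hj⟩⟩
    · obtain ⟨j, hj⟩ := hwsurj (z i) (Finset.mem_insert_of_mem h)
      exact ⟨j, Or.inl ⟨h, hj⟩⟩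
  choose σ hσ using hex
  have hσinj : Function.Injective σ := by
    intro i j hij
    apply hzinj
    rcases hσ i with ⟨h1, h2⟩ | ⟨h1, h2⟩ <;> rcases hσ j with ⟨h3, h4⟩ | ⟨h3, h4⟩ <;>
      rw [hij] at h2
    · rw [← h2, ← h4]
    · exact (hyS (by rw [← h4, h2]; exact h1)).elim
    · exact (hyS (by rw [← h2, h4]; exact h3)).elim
    · rw [h1, h3]
  have hmid : ∀ i, ∃ m : G.Walk (z i) (w (σ i)), ∀ v ∈ m.support, v = z i ∨ v = w (σ i) := by
    intro i
    rcases hσ i with ⟨h1, h2⟩ | ⟨h1, h2⟩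
    · rw [h2]; exact ⟨Walk.nil, by simp⟩
    · rw [h1, h2]; exact ⟨hxy.toWalk, by simp⟩
  choose m hm using hmid
  refine hasLinkage_of_walks a (fun i => b (σ i))
    (fun i => ((p i).mapLe hle).append ((m i).append ((q (σ i)).mapLe hle).reverse)) ha
    (fun i => hb _) ?_
  have hsupp : ∀ i v, v ∈ (((p i).mapLe hle).append
      ((m i).append ((q (σ i)).mapLe hle).reverse)).support →
      v ∈ (p i).support ∨ v ∈ (q (σ i)).support := by
    intro i v hv
    rw [Walk.mem_support_append_iff, Walk.mem_support_append_iff, Walk.support_reverse,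
      List.mem_reverse, Walk.support_mapLe_eq_support, Walk.support_mapLe_eq_support] at hv
    rcases hv with h | h | h
    · exact Or.inl h
    · rcases hm i v h with rfl | rfl
      · exact Or.inl (Walk.end_mem_support _)
      · exact Or.inr (Walk.end_mem_support _)
    · exact Or.inr h
  have hcross : ∀ i j v, v ∈ (p i).support → v ∈ (q (σ j)).support → i = j := by
    intro i j v hv hv'
    have hvS := hmeet _ _ v hv hv'
    have e1 := hzend i v hv (Finset.mem_insert_of_mem hvS)
    have e2 := hwend _ v hv' (Finset.mem_insert_of_mem hvS)
    apply hzinj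
    rcases hσ j with ⟨-, h⟩ | ⟨-, h⟩
    · rw [← e1, ← h, e2]
    · exact (hyS (by rw [← h, ← e2]; exact hvS)).elim
  intro i j hij v hv hv'
  rcases hsupp i v hv with h | h <;> rcases hsupp j v hv' with h' | h'
  · exact hpd i j hij v h h'
  · exact hij (hcross i j v h h')
  · exact hij (hcross j i v h' h).symm
  · exact hqd _ _ (fun h => hij (hσinj h)) v h h'

/-- Menger's theorem for vertex-disjoint paths between two sets. -/
theorem hasLinkage_of_forall_separates [Finite V] (G : SimpleGraph V) (X Y : Finset V) (n : ℕ)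
    (h : ∀ T, G.Separates X Y T → n ≤ T.card) : G.HasLinkage X Y n := by
  induction G using WellFoundedLT.induction generalizing X Y with
  | ind G ih =>
  by_cases hG : ∃ x y, G.Adj x y
  swap
  · push Not at hG
    -- Without edges all walks are trivial, so `X ∩ Y` separates and its vertices serve as paths of
    -- length zero.
    have hc := h (X ∩ Y) (by
      intro x hx y hy p
      cases p with
      | nil => exact ⟨x, by simp, Finset.mem_inter.2 ⟨hx, hy⟩⟩
      | cons hadj _ => exact (hG _ _ hadj).elim)
    let e := Finset.orderEmbOfCardLe (Finset.univ : Finset (Fin (X ∩ Y).card)) (k := n)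
      (by simpa using hc)
    have hmem : ∀ i, ((X ∩ Y).equivFin.symm (e i) : V) ∈ X ∩ Y := fun i => Subtype.coe_prop _
    refine ⟨fun i => (X ∩ Y).equivFin.symm (e i), fun i => (X ∩ Y).equivFin.symm (e i),
      fun i => Walk.nil, fun i => (Finset.mem_inter.1 (hmem i)).1,
      fun i => (Finset.mem_inter.1 (hmem i)).2, fun i => Walk.IsPath.nil, ?_⟩
    intro i j hij v hv hv'
    rw [Walk.support_nil, List.mem_singleton] at hv hv'
    exact hij (e.injective ((X ∩ Y).equivFin.symm.injective (Subtype.ext (hv.symm.trans hv'))))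
  obtain ⟨x₀, y₀, hxy₀⟩ := hG
  set G' := G.deleteEdges {s(x₀, y₀)} with hG'
  have hle : G' ≤ G := G.deleteEdges_le _
  have hlt : G' < G := lt_of_le_of_ne hle fun heq => by
    have : G'.Adj x₀ y₀ := heq ▸ hxy₀
    simp [hG'] at this
  by_cases hsep : ∀ T, G'.Separates X Y T → n ≤ T.card
  · obtain ⟨a, b, p, ha, hb, hp, hd⟩ := ih G' hlt X Y hsep
    refine hasLinkage_of_walks a b (fun i => (p i).mapLe hle) ha hb fun i j hij v => ?_
    rw [Walk.support_mapLe_eq_support, Walk.support_mapLe_eq_support]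
    exact hd i j hij v
  push Not at hsep
  -- `S` separates after the deletion but is too small to separate in `G`, so every walk from `X` to
  -- `Y` avoiding `S` uses the deleted edge. Adding either end of it to `S` gives a separator of
  -- `G`, whence `|S| = n - 1`.
  obtain ⟨S, hS, hSn⟩ := hsep
  have hnS : ¬ G.Separates X Y S := fun h' => (h S h').not_gt hSn
  have hadj₀ : ∀ u v, G.Adj u v → G'.Adj u v ∨ (u = x₀ ∧ v = y₀) ∨ (u = y₀ ∧ v = x₀) := by
    intro u v huv
    by_cases huv' : s(u, v) = s(x₀, y₀)
    · right; simpa using huv'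
    · left; simp only [hG', deleteEdges_adj]; exact ⟨huv, huv'⟩
  have hcross : ∀ a ∈ X, ∀ b ∈ Y, ∀ p : G.Walk a b, (∀ v ∈ p.support, v ∉ S) →
      ∃ u v, u ∈ p.support ∧ v ∈ p.support ∧ G.Adj u v ∧ ¬ G'.Adj u v ∧
        G'.ReachableAvoiding X S u ∧ ¬ G'.ReachableAvoiding X S v := by
    intro a ha b hb p hp
    obtain ⟨d, hd, hd1, hd2⟩ := p.exists_boundary_dart {v | G'.ReachableAvoiding X S v}
      (ReachableAvoiding.of_mem ha (hp a p.start_mem_support))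
      (fun hb' => hS.not_reachableAvoiding hb'
        (ReachableAvoiding.of_mem hb (hp b p.end_mem_support)))
    have hv := p.dart_snd_mem_support_of_mem_darts hd
    exact ⟨d.fst, d.snd, p.dart_fst_mem_support_of_mem_darts hd, hv, d.adj,
      fun h' => hd2 (hd1.adj h' (hp _ hv)), hd1, hd2⟩
  obtain ⟨x, y, hadj, hxy, hxR, hyR, hyS⟩ : ∃ x y,
      (∀ u v, G.Adj u v → G'.Adj u v ∨ (u = x ∧ v = y) ∨ (u = y ∧ v = x)) ∧ G.Adj x y ∧
      G'.ReachableAvoiding X S x ∧ ¬ G'.ReachableAvoiding X S y ∧ y ∉ S := by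
    unfold Separates at hnS
    push Not at hnS
    obtain ⟨a, ha, b, hb, p, hp⟩ := hnS
    obtain ⟨u, v, hu, hv, huv, huv', h1, h2⟩ := hcross a ha b hb p hp
    refine ⟨u, v, ?_, huv, h1, h2, hp v hv⟩
    rcases hadj₀ u v huv with h | ⟨rfl, rfl⟩ | ⟨rfl, rfl⟩
    · exact (huv' h).elim
    · exact hadj₀
    · exact fun a b hab => (hadj₀ a b hab).imp_right Or.symm
  have hxS : x ∉ S := hxR.not_mem
  have hboth : ∀ a ∈ X, ∀ b ∈ Y, ∀ p : G.Walk a b, (∀ v ∈ p.support, v ∉ S) →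
      x ∈ p.support ∧ y ∈ p.support := by
    intro a ha b hb p hp
    obtain ⟨u, v, hu, hv, huv, huv', h1, h2⟩ := hcross a ha b hb p hp
    rcases hadj u v huv with h | ⟨rfl, rfl⟩ | ⟨rfl, rfl⟩
    · exact (huv' h).elim
    · exact ⟨hu, hv⟩
    · exact (hyR h1).elim
  have hsx : G.Separates X Y (insert x S) := by
    intro a ha b hb p
    by_cases hp : ∀ v ∈ p.support, v ∉ S
    · exact ⟨x, (hboth a ha b hb p hp).1, Finset.mem_insert_self _ _⟩
    · push Not at hp
      obtain ⟨v, hv, hvS⟩ := hp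
      exact ⟨v, hv, Finset.mem_insert_of_mem hvS⟩
  have hsy : G.Separates X Y (insert y S) := by
    intro a ha b hb p
    by_cases hp : ∀ v ∈ p.support, v ∉ S
    · exact ⟨y, (hboth a ha b hb p hp).2, Finset.mem_insert_self _ _⟩
    · push Not at hp
      obtain ⟨v, hv, hvS⟩ := hp
      exact ⟨v, hv, Finset.mem_insert_of_mem hvS⟩
  have hn : S.card + 1 = n := by
    have := h _ hsx
    rw [Finset.card_insert_of_notMem hxS] at this
    omega
  exact HasLinkage.glue hle hxy hxS hyS hn hS
    (ih G' hlt X (insert x S) fun T hT => h T (hsx.of_separates_insert hadj hyR hT))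
    (ih G' hlt Y (insert y S) fun T hT => h T
      (Separates.of_separates_insert (fun u v huv => (hadj u v huv).imp_right Or.symm)
        (hS.not_reachableAvoiding hxR) hsy.symm hT).symm)

/-- Large subsets of a linked set are joined by many disjoint paths inside it. -/
theorem LinkedOn.exists_linkage [Finite V] {H X Y : Finset V} {s : ℕ} (hH : G.LinkedOn H s)
    (hX : X ⊆ H) (hY : Y ⊆ H) (hXs : s ≤ X.card) (hYs : s ≤ Y.card) :
    ∃ (a b : Fin s → V) (p : ∀ i, G.Walk (a i) (b i)), (∀ i, a i ∈ X) ∧ (∀ i, b i ∈ Y) ∧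
      (∀ i, ∀ v ∈ (p i).support, v ∈ H) ∧
      ∀ i j, i ≠ j → ∀ v ∈ (p i).support, v ∉ (p j).support := by
  -- Only edges inside `H` are kept, so that the paths from Menger's theorem stay in `H`.
  let G' : SimpleGraph V :=
    { Adj := fun u v => G.Adj u v ∧ u ∈ H ∧ v ∈ H
      symm := ⟨fun u v h => ⟨h.1.symm, h.2.2, h.2.1⟩⟩
      loopless := ⟨fun u h => h.1.ne rfl⟩ }
  have hle : G' ≤ G := fun u v h => h.1
  have hsub : ∀ {u v : V} (p : G'.Walk u v), u ∈ H → ∀ x ∈ p.support, x ∈ H := by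
    intro u v p
    induction p with
    | nil => intro hu x hx; simp only [Walk.support_nil, List.mem_singleton] at hx; rwa [hx]
    | cons hadj p ih =>
      intro hu x hx
      rw [Walk.support_cons, List.mem_cons] at hx
      rcases hx with rfl | hx
      · exact hu
      · exact ih hadj.2.2 x hx
  obtain ⟨a, b, p, ha, hb, -, hd⟩ := hasLinkage_of_forall_separates G' X Y s (by
    intro T hT
    by_contra hlt
    rw [not_le] at hlt
    set R := H.filter (fun v => G'.ReachableAvoiding X T v) with hR
    have hmem : ∀ v, v ∈ R ↔ v ∈ H ∧ G'.ReachableAvoiding X T v := fun v => by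
      rw [hR, Finset.mem_filter]
    obtain ⟨x, hx, hxT⟩ := Finset.exists_mem_notMem_of_card_lt_card (hlt.trans_le hXs)
    obtain ⟨y, hy, hyT⟩ := Finset.exists_mem_notMem_of_card_lt_card (hlt.trans_le hYs)
    have hxR := ReachableAvoiding.of_mem (G := G') hx hxT
    have hyR : ¬ G'.ReachableAvoiding X T y := fun h =>
      hT.not_reachableAvoiding h (ReachableAvoiding.of_mem hy hyT)
    -- A separator `T` with fewer than `s` vertices would give a separation of `H` whose overlap
    -- lies in `T`.
    rcases hH (R ∪ T ∩ H) (H \ R) (by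
        ext v
        have := hmem v
        simp only [Finset.mem_union, Finset.mem_inter, Finset.mem_sdiff]
        tauto)
      (lt_of_le_of_lt (Finset.card_le_card (by
        intro v
        simp only [Finset.mem_union, Finset.mem_inter, Finset.mem_sdiff]
        tauto)) hlt)
      (by
        intro u hu v hv huv
        simp only [Finset.mem_union, Finset.mem_inter, Finset.mem_sdiff] at hu hv
        have huH : u ∈ H := by
          rcases hu.1 with h | h
          · exact ((hmem u).1 h).1
          · exact h.2
        have huR : u ∈ R := by tauto
        have hvT : v ∉ T := by tauto
        have hvR : v ∈ R := (hmem v).2 ⟨hv.1.1, ((hmem u).1 huR).2.adj ⟨huv, huH, hv.1.1⟩ hvT⟩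
        exact hv.1.2 hvR) with h | h
    · have := h (Finset.mem_union_left _ ((hmem x).2 ⟨hX hx, hxR⟩))
      exact (Finset.mem_sdiff.1 this).2 ((hmem x).2 ⟨hX hx, hxR⟩)
    · have := h (Finset.mem_sdiff.2 ⟨hY hy, fun h' => hyR ((hmem y).1 h').2⟩)
      simp only [Finset.mem_union, Finset.mem_inter] at this
      rcases this with h' | h'
      · exact hyR ((hmem y).1 h').2
      · exact hyT h'.1)
  refine ⟨a, b, fun i => (p i).mapLe hle, ha, hb, fun i v => ?_, fun i j hij v => ?_⟩
  · rw [Walk.support_mapLe_eq_support]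
    exact hsub (p i) (hX (ha i)) v
  · rw [Walk.support_mapLe_eq_support, Walk.support_mapLe_eq_support]
    exact hd i j hij v

/-! ### Longest paths, cycles and rerouting -/

theorem Walk.IsPath.append_of_meet {u v w : V} {p : G.Walk u v} {q : G.Walk v w} (hp : p.IsPath)
    (hq : q.IsPath) (h : ∀ x ∈ p.support, x ∈ q.support → x = v) : (p.append q).IsPath := by
  rw [Walk.isPath_def, Walk.support_append, List.nodup_append']
  refine ⟨hp.support_nodup, hq.support_nodup.tail, fun x hx hx' => ?_⟩
  have := h x hx (List.mem_of_mem_tail hx')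
  subst this
  have hnd := hq.support_nodup
  rw [← Walk.cons_tail_support] at hnd
  exact (List.nodup_cons.1 hnd).1 hx'

theorem Walk.IsPath.exists_split {u v a : V} {p : G.Walk u v} (hp : p.IsPath) {m : ℕ}
    (hm : m ≤ p.length) (ha : p.getVert m = a) :
    (∃ t : G.Walk u a, t.IsPath ∧ t.length = m ∧ ∀ x ∈ t.support, ∃ k ≤ m, p.getVert k = x) ∧
    ∃ d : G.Walk a v, d.IsPath ∧ d.length = p.length - m ∧
      ∀ x ∈ d.support, ∃ k, m ≤ k ∧ k ≤ p.length ∧ p.getVert k = x := by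
  subst ha
  refine ⟨⟨p.take m, hp.take m, by rw [Walk.take_length]; omega, fun x hx => ?_⟩,
    ⟨p.drop m, hp.drop m, by rw [Walk.drop_length], fun x hx => ?_⟩⟩
  · obtain ⟨k, hk, hkl⟩ := Walk.mem_support_iff_exists_getVert.1 hx
    rw [Walk.take_length] at hkl
    rw [Walk.take_getVert] at hk
    exact ⟨_, Nat.min_le_left _ _, hk⟩
  · obtain ⟨k, hk, hkl⟩ := Walk.mem_support_iff_exists_getVert.1 hx
    rw [Walk.drop_length] at hkl
    rw [Walk.drop_getVert] at hk
    exact ⟨_, by omega, by omega, hk⟩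

theorem exists_longest_path_in {M : Finset V} (hM : M.Nonempty) :
    ∃ (u v : V) (p : G.Walk u v), p.IsPath ∧ (∀ x ∈ p.support, x ∈ M) ∧
      ∀ (a b : V) (q : G.Walk a b), q.IsPath → (∀ x ∈ q.support, x ∈ M) →
        q.length ≤ p.length := by
  let P : ℕ → Prop := fun n => ∃ (u v : V) (p : G.Walk u v), p.IsPath ∧
    (∀ x ∈ p.support, x ∈ M) ∧ p.length = n
  have hbound : ∀ (a b : V) (q : G.Walk a b), q.IsPath → (∀ x ∈ q.support, x ∈ M) →
      q.length ≤ M.card := by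
    intro a b q hq hqM
    have h1 : q.support.toFinset ⊆ M := fun x hx => hqM x (List.mem_toFinset.1 hx)
    have h2 := Finset.card_le_card h1
    rw [List.toFinset_card_of_nodup hq.support_nodup, Walk.length_support] at h2
    omega
  obtain ⟨x, hx⟩ := hM
  have h0 : P 0 := ⟨x, x, Walk.nil, Walk.IsPath.nil, by simpa using hx, rfl⟩
  obtain ⟨u, v, p, hp, hpM, hpl⟩ := Nat.findGreatest_spec (P := P) (Nat.zero_le M.card) h0
  exact ⟨u, v, p, hp, hpM, fun a b q hq hqM => hpl ▸
    Nat.le_findGreatest (hbound a b q hq hqM) ⟨a, b, q, hq, hqM, rfl⟩⟩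

/-- A set of minimum degree at least `d ≥ 2` contains a cycle of length at least `d + 1`. -/
theorem exists_cycle_of_le_degree {M : Finset V} (hM : M.Nonempty) {d : ℕ} (hd : 2 ≤ d)
    (hdeg : ∀ v ∈ M, d ≤ (M.filter (G.Adj v)).card) :
    ∃ (v : V) (c : G.Walk v v), c.IsCycle ∧ (∀ x ∈ c.support, x ∈ M) ∧ d + 1 ≤ c.length := by
  obtain ⟨u, v, p, hp, hpM, hmax⟩ := exists_longest_path_in (G := G) hM
  have huM := hpM u p.start_mem_support
  have hon : ∀ w ∈ M, G.Adj u w → w ∈ p.support := by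
    intro w hw huw
    by_contra hwp
    have := hmax _ _ (Walk.cons huw.symm p) (hp.cons hwp) (fun x hx => by
      rw [Walk.support_cons, List.mem_cons] at hx
      rcases hx with rfl | hx
      · exact hw
      · exact hpM x hx)
    rw [Walk.length_cons] at this
    omega
  -- The neighbours of `u` sit at distinct positions from `1` on; the `d - 1` positions below `d`
  -- cannot hold them all.
  obtain ⟨w, hwM, huw, m, hm, hmw, hdm⟩ : ∃ w ∈ M, G.Adj u w ∧ ∃ m ≤ p.length,
      p.getVert m = w ∧ d ≤ m := by
    by_contra! hcon
    have hsub : M.filter (G.Adj u) ⊆ (Finset.Ico 1 d).image p.getVert := by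
      intro w hw
      obtain ⟨hwM, huw⟩ := Finset.mem_filter.1 hw
      obtain ⟨m, hm, hml⟩ := Walk.mem_support_iff_exists_getVert.1 (hon w hwM huw)
      refine Finset.mem_image.2 ⟨m, Finset.mem_Ico.2 ⟨?_, hcon w hwM huw m hml hm⟩, hm⟩
      by_contra h0
      have : m = 0 := by omega
      rw [this, Walk.getVert_zero] at hm
      exact huw.ne hm
    have h1 := (Finset.card_le_card hsub).trans Finset.card_image_le
    have h2 := hdeg u huM
    rw [Nat.card_Ico] at h1
    omega
  obtain ⟨⟨t, ht, htl, hts⟩, -⟩ := hp.exists_split hm hmw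
  refine ⟨u, t.append huw.symm.toWalk, Walk.IsPath.isCycle_append ht ?_ ?_ (Or.inl (by omega)),
    fun x hx => ?_, ?_⟩
  · simp [huw.ne']
  · have hnd := ht.support_nodup
    rw [← Walk.cons_tail_support] at hnd
    simpa using (List.nodup_cons.1 hnd).1
  · rw [Walk.mem_support_append_iff] at hx
    have htM : ∀ x ∈ t.support, x ∈ M := fun x hx => by
      obtain ⟨k, -, hk⟩ := hts x hx
      exact hk ▸ hpM _ (p.getVert_mem_support k)
    rcases hx with hx | hx
    · exact htM x hx
    · simp only [Walk.support_cons, Walk.support_nil, List.mem_cons, List.not_mem_nil,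
        or_false] at hx
      rcases hx with rfl | rfl
      · exact hwM
      · exact huM
  · rw [Walk.length_append, htl]
    simp
    omega

/-- Two vertices of a cycle are joined by a path along at least half of the cycle. -/
theorem Walk.IsCycle.exists_long_arc {v y z : V} {c : G.Walk v v} (hc : c.IsCycle)
    (hy : y ∈ c.support) (hz : z ∈ c.support) (hyz : y ≠ z) :
    ∃ q : G.Walk y z, q.IsPath ∧ (∀ x ∈ q.support, x ∈ c.support) ∧ c.length ≤ 2 * q.length := by
  have hc' := hc.rotate hy
  have hmem : ∀ x, x ∈ (c.rotate y hy).support ↔ x ∈ c.support := fun x =>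
    c.mem_support_rotate_iff y hy
  have hz' := (hmem z).2 hz
  have hspec := (c.rotate y hy).take_spec hz'
  have hlen : c.length = ((c.rotate y hy).takeUntil z hz').length +
      ((c.rotate y hy).dropUntil z hz').length := by
    rw [← Walk.length_append, hspec, Walk.length_rotate]
  have h1 := hc'.isPath_takeUntil hz'
  have h2 : ((c.rotate y hy).dropUntil z hz').IsPath := by
    rw [← hspec] at hc'
    exact hc'.isPath_of_append_right (Walk.not_nil_of_ne hyz)
  rcases le_total ((c.rotate y hy).takeUntil z hz').length
    ((c.rotate y hy).dropUntil z hz').length with h | h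
  · refine ⟨((c.rotate y hy).dropUntil z hz').reverse, h2.reverse, fun x hx => ?_, ?_⟩
    · rw [Walk.support_reverse, List.mem_reverse] at hx
      exact (hmem x).1 (Walk.support_dropUntil_subset_support _ _ hx)
    · rw [Walk.length_reverse]; omega
  · refine ⟨_, h1, fun x hx => ?_, ?_⟩
    · exact (hmem x).1 (Walk.support_takeUntil_subset_support _ _ hx)
    · omega

/-- A walk between two sets contains a path that meets them only in its ends. -/
theorem Walk.exists_path_between {X Y : Finset V} {a b : V} (p : G.Walk a b) (ha : a ∈ X)
    (hb : b ∈ Y) : ∃ (x y : V) (q : G.Walk x y), x ∈ X ∧ y ∈ Y ∧ q.IsPath ∧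
      (∀ v ∈ q.support, v ∈ p.support) ∧ (∀ v ∈ q.support, v ∈ X → v = x) ∧
      ∀ v ∈ q.support, v ∈ Y → v = y := by
  obtain ⟨y, hyY, hy, hyf⟩ := p.exists_mem_support_forall_mem_support_imp_eq Y
    ⟨b, Finset.mem_filter.2 ⟨hb, p.end_mem_support⟩⟩
  obtain ⟨x, hxX, hx, hxf⟩ :=
    (p.takeUntil y hy).reverse.exists_mem_support_forall_mem_support_imp_eq X
    ⟨a, Finset.mem_filter.2 ⟨ha, Walk.end_mem_support _⟩⟩
  set w := ((p.takeUntil y hy).reverse.takeUntil x hx).reverse with hw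
  have h1 : ∀ v ∈ w.support, v ∈ ((p.takeUntil y hy).reverse.takeUntil x hx).support :=
    fun v hv => by rwa [hw, Walk.support_reverse, List.mem_reverse] at hv
  have h2 : ∀ v ∈ w.support, v ∈ (p.takeUntil y hy).support := fun v hv => by
    have := Walk.support_takeUntil_subset_support _ _ (h1 v hv)
    rwa [Walk.support_reverse, List.mem_reverse] at this
  have h3 := fun v => w.support_bypass_subset_support (a := v)
  exact ⟨x, y, w.bypass, hxX, hyY, w.bypass_isPath,
    fun v hv => p.support_takeUntil_subset_support hy (h2 v (h3 v hv)),
    fun v hv hvX => hxf v hvX (h1 v (h3 v hv)), fun v hv hvY => hyf v hvY (h2 v (h3 v hv))⟩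

/-- Replacing a short segment of a path by a detour through a disjoint set. -/
theorem Walk.IsPath.exists_reroute {u v a b y z : V} {p : G.Walk u v} (hp : p.IsPath)
    {m n : ℕ} (hmn : m < n) (hn : n ≤ p.length) (ha : p.getVert m = a) (hb : p.getVert n = b)
    {C : Finset V} (hC : ∀ x ∈ p.support, x ∉ C)
    (w : G.Walk a y) (w' : G.Walk b z) (q : G.Walk y z) (hw : w.IsPath) (hw' : w'.IsPath)
    (hq : q.IsPath) (hqC : ∀ x ∈ q.support, x ∈ C)
    (hwp : ∀ x ∈ w.support, x ∈ p.support → x = a) (hwp' : ∀ x ∈ w'.support, x ∈ p.support → x = b)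
    (hwC : ∀ x ∈ w.support, x ∈ C → x = y) (hwC' : ∀ x ∈ w'.support, x ∈ C → x = z)
    (hww : ∀ x ∈ w.support, x ∉ w'.support) :
    ∃ p' : G.Walk u v, p'.IsPath ∧ p.length + q.length + 2 ≤ p'.length + (n - m) ∧
      ∀ x ∈ p'.support, x ∈ p.support ∨ x ∈ w.support ∨ x ∈ q.support ∨ x ∈ w'.support := by
  obtain ⟨⟨t, ht, htl, hts⟩, -⟩ := hp.exists_split (by omega) ha
  obtain ⟨-, ⟨d, hd, hdl, hds⟩⟩ := hp.exists_split hn hb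
  have htp : ∀ x ∈ t.support, x ∈ p.support := fun x hx => by
    obtain ⟨k, -, rfl⟩ := hts x hx
    exact p.getVert_mem_support k
  have hdp : ∀ x ∈ d.support, x ∈ p.support := fun x hx => by
    obtain ⟨k, -, -, rfl⟩ := hds x hx
    exact p.getVert_mem_support k
  have htd : ∀ x ∈ t.support, x ∉ d.support := fun x hx hx' => by
    obtain ⟨k, hk, hkx⟩ := hts x hx
    obtain ⟨l, hl, hl', hlx⟩ := hds x hx'
    have := hp.getVert_injOn (show k ∈ {i | i ≤ p.length} by simp; omega)
      (show l ∈ {i | i ≤ p.length} by simpa using hl') (hkx.trans hlx.symm)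
    omega
  have hlw : 1 ≤ w.length := by
    by_contra h0
    have := Walk.eq_of_length_eq_zero (p := w) (by omega)
    exact hC a (htp a t.end_mem_support) (this ▸ hqC y q.start_mem_support)
  have hlw' : 1 ≤ w'.length := by
    by_contra h0
    have := Walk.eq_of_length_eq_zero (p := w') (by omega)
    exact hC b (hdp b d.start_mem_support) (this ▸ hqC z q.end_mem_support)
  have h1 : (w'.reverse.append d).IsPath := hw'.reverse.append_of_meet hd fun x hx hxd =>
    hwp' x (by simpa using hx) (hdp x hxd)
  have h2 : (q.append (w'.reverse.append d)).IsPath := hq.append_of_meet h1 fun x hx hxd => by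
    rw [Walk.mem_support_append_iff, Walk.support_reverse, List.mem_reverse] at hxd
    rcases hxd with h | h
    · exact hwC' x h (hqC x hx)
    · exact (hC x (hdp x h) (hqC x hx)).elim
  have h3 : (w.append (q.append (w'.reverse.append d))).IsPath :=
    hw.append_of_meet h2 fun x hx hxd => by
      rw [Walk.mem_support_append_iff, Walk.mem_support_append_iff, Walk.support_reverse,
        List.mem_reverse] at hxd
      rcases hxd with h | h | h
      · exact hwC x hx (hqC x h)
      · exact (hww x hx h).elim
      · have := hwp x hx (hdp x h)
        exact (htd a t.end_mem_support (this ▸ h)).elim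
  have h4 : (t.append (w.append (q.append (w'.reverse.append d)))).IsPath :=
    ht.append_of_meet h3 fun x hx hxd => by
      rw [Walk.mem_support_append_iff, Walk.mem_support_append_iff, Walk.mem_support_append_iff,
        Walk.support_reverse, List.mem_reverse] at hxd
      rcases hxd with h | h | h | h
      · exact hwp x h (htp x hx)
      · exact (hC x (htp x hx) (hqC x h)).elim
      · have := hwp' x h (htp x hx)
        exact (htd x hx (this ▸ d.start_mem_support)).elim
      · exact (htd x hx h).elim
  refine ⟨_, h4, ?_, fun x hx => ?_⟩
  · simp only [Walk.length_append, Walk.length_reverse, htl, hdl]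
    omega
  · simp only [Walk.mem_support_append_iff, Walk.support_reverse, List.mem_reverse] at hx
    rcases hx with h | h | h | h | h
    · exact Or.inl (htp x h)
    · exact Or.inr (Or.inl h)
    · exact Or.inr (Or.inr (Or.inl h))
    · exact Or.inr (Or.inr (Or.inr h))
    · exact Or.inl (hdp x h)

/-- A linked set of large chromatic number contains a path that is long or has itself large
chromatic number. -/
theorem LinkedOn.exists_long_path [Finite V] {H : Finset V} {s q : ℕ} (hH : G.LinkedOn H s)
    (hsq : s ≤ q + 1) (hq : 2 ≤ q) (hcol : ¬ G.ColorableOn H (2 * q)) :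
    ∃ (u v : V) (p : G.Walk u v), p.IsPath ∧ (∀ x ∈ p.support, x ∈ H) ∧
      (¬ G.ColorableOn p.support.toFinset q ∨ (s - 1) * ((q + 1) / 2) ≤ p.length) := by
  have hne : H.Nonempty := by
    rw [Finset.nonempty_iff_ne_empty]
    rintro rfl
    exact hcol (colorableOn_empty _)
  obtain ⟨u, v, p, hp, hpH, hmax⟩ := exists_longest_path_in (G := G) hne
  refine ⟨u, v, p, hp, hpH, ?_⟩
  by_contra! hcon
  obtain ⟨hpc, hlen⟩ := hcon
  have hpH' : p.support.toFinset ⊆ H := fun x hx => hpH x (List.mem_toFinset.1 hx)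
  have hrest : ¬ G.ColorableOn (H \ p.support.toFinset) q := by
    intro h
    have := h.union hpc
    rw [Finset.sdiff_union_of_subset hpH', ← two_mul] at this
    exact hcol this
  obtain ⟨M, hMsub, hM⟩ := exists_criticalOn_subset hrest
  obtain ⟨o, c, hc, hcM, hcl⟩ := exists_cycle_of_le_degree hM.nonempty hq
    (fun v hv => hM.le_card_filter_adj hv)
  have hcH : ∀ x ∈ c.support, x ∈ H ∧ x ∉ p.support := fun x hx => by
    have := Finset.mem_sdiff.1 (hMsub (hcM x hx))
    exact ⟨this.1, fun h => this.2 (List.mem_toFinset.2 h)⟩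
  -- The cycle minus an edge is a path in `H`, hence no longer than `p`; so `p` has enough vertices
  -- for `s` disjoint links.
  have hpl : q ≤ p.length := by
    have h1 := hmax _ _ c.tail hc.isPath_tail (fun x hx =>
      (hcH x (by
        rw [Walk.support_tail_of_not_nil _ hc.not_nil] at hx
        exact List.mem_of_mem_tail hx)).1)
    have h2 := Walk.length_tail_add_one hc.not_nil
    omega
  have hXc : s ≤ p.support.toFinset.card := by
    rw [List.toFinset_card_of_nodup hp.support_nodup, Walk.length_support]; omega
  have hYc : s ≤ c.support.toFinset.card := by
    have h1 : c.support.tail.toFinset ⊆ c.support.toFinset := fun x hx =>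
      List.mem_toFinset.2 (List.mem_of_mem_tail (List.mem_toFinset.1 hx))
    have h2 := Finset.card_le_card h1
    rw [List.toFinset_card_of_nodup hc.support_nodup, List.length_tail, Walk.length_support] at h2
    omega
  obtain ⟨a₀, b₀, w₀, ha₀, hb₀, hw₀, hd₀⟩ := hH.exists_linkage hpH'
    (fun x hx => (hcH x (List.mem_toFinset.1 hx)).1) hXc hYc
  choose a b w ha hb hw hsub hwX hwY using
    fun i => (w₀ i).exists_path_between (ha₀ i) (hb₀ i)
  have hd : ∀ i j, i ≠ j → ∀ v ∈ (w i).support, v ∉ (w j).support := fun i j hij v hv hv' =>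
    hd₀ i j hij v (hsub i v hv) (hsub j v hv')
  have hpos : ∀ i, ∃ m, p.getVert m = a i ∧ m ≤ p.length := fun i =>
    Walk.mem_support_iff_exists_getVert.1 (List.mem_toFinset.1 (ha i))
  choose m hm hml using hpos
  set g := (q + 1) / 2 with hg
  -- Rerouting between two feet gains an arc of at least half the cycle and two link edges, so
  -- maximality of `p` forces the replaced segment to be at least as long.
  have hstep : ∀ i j, m i < m j → g + 2 ≤ m j - m i := by
    intro i j hij
    have hij' : i ≠ j := fun h => by subst h; exact lt_irrefl _ hij
    have hbne : b i ≠ b j := fun h =>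
      hd i j hij' _ (w i).end_mem_support (by rw [h]; exact (w j).end_mem_support)
    obtain ⟨r, hr, hrc, hrl⟩ := hc.exists_long_arc (List.mem_toFinset.1 (hb i))
      (List.mem_toFinset.1 (hb j)) hbne
    obtain ⟨p', hp', hpl', hps'⟩ := hp.exists_reroute hij (hml j) (hm i) (hm j)
      (C := c.support.toFinset) (fun x hx hx' => (hcH x (List.mem_toFinset.1 hx')).2 hx)
      (w i) (w j) r (hw i) (hw j) hr (fun x hx => List.mem_toFinset.2 (hrc x hx))
      (fun x hx hx' => hwX i x hx (List.mem_toFinset.2 hx'))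
      (fun x hx hx' => hwX j x hx (List.mem_toFinset.2 hx'))
      (hwY i) (hwY j) (hd i j hij')
    have := hmax _ _ p' hp' (fun x hx => by
      rcases hps' x hx with h | h | h | h
      · exact hpH x h
      · exact hw₀ i x (hsub i x h)
      · exact (hcH x (hrc x h)).1
      · exact hw₀ j x (hsub j x h))
    omega
  have hminj : Function.Injective m := fun i j hij => by
    by_contra hne
    exact hd i j hne _ (w i).start_mem_support
      (by rw [← hm i, hij, hm j]; exact (w j).start_mem_support)
  -- Cut into blocks of `g + 2` consecutive positions, `p` has at most one foot in each block.
  have hblock : Function.Injective fun i => m i / (g + 2) := by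
    intro i j hij
    by_contra hne
    have h1 := Nat.div_add_mod (m i) (g + 2)
    have h2 := Nat.div_add_mod (m j) (g + 2)
    have h3 := Nat.mod_lt (m i) (show 0 < g + 2 by omega)
    have h4 := Nat.mod_lt (m j) (show 0 < g + 2 by omega)
    dsimp only at hij
    rw [hij] at h1
    rcases lt_trichotomy (m i) (m j) with h | h | h
    · have := hstep i j h; omega
    · exact hne (hminj h)
    · have := hstep j i h; omega
  have hcard : s ≤ p.length / (g + 2) + 1 := by
    have h1 : Finset.univ.image (fun i => m i / (g + 2)) ⊆
        Finset.range (p.length / (g + 2) + 1) := by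
      intro x hx
      obtain ⟨i, -, rfl⟩ := Finset.mem_image.1 hx
      exact Finset.mem_range.2 (Nat.lt_succ_of_le (Nat.div_le_div_right (hml i)))
    have h2 := Finset.card_le_card h1
    rw [Finset.card_image_of_injective _ hblock, Finset.card_range] at h2
    simpa using h2
  have h1 : (s - 1) * (g + 2) ≤ p.length / (g + 2) * (g + 2) :=
    Nat.mul_le_mul_right _ (Nat.sub_le_iff_le_add.2 hcard)
  have h2 := Nat.div_mul_le_self p.length (g + 2)
  have h3 : (s - 1) * g ≤ (s - 1) * (g + 2) := Nat.mul_le_mul_left _ (by omega)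
  exact (h3.trans (h1.trans h2)).not_gt hlen

theorem rpow_le_mul_sqrt {r : ℕ} (hr : 3 ≤ r) {x : ℝ} (hx : 1 ≤ x) :
    x ^ ((r : ℝ) / ((r : ℝ) - 1)) ≤ x * √x := by
  have hr' : (3 : ℝ) ≤ r := by exact_mod_cast hr
  have hexp : (r : ℝ) / ((r : ℝ) - 1) ≤ 1 + 1 / 2 := by
    rw [div_le_iff₀ (by linarith)]
    linarith
  calc x ^ ((r : ℝ) / ((r : ℝ) - 1)) ≤ x ^ ((1 : ℝ) + 1 / 2) :=
        Real.rpow_le_rpow_of_exponent_le hx hexp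
    _ = x * √x := by
        rw [Real.rpow_add (by linarith), Real.rpow_one, Real.sqrt_eq_rpow]

/-- With `s` the integer square root of `q`, passing to a linked set costs `2 * s ^ 2 ≤ 2 * q`
colours, and a long path has order `s * q`. In the other outcome the constant `12` comes from `2 * 3
^ (r / (r - 1)) ≤ 2 * 6`. -/
theorem exists_long_path_of_cliqueFree [Finite V] {r q : ℕ} (hr : 3 ≤ r)
    (hcl : G.CliqueFree (r + 1)) (hq : 16 ≤ q) {A : Finset V} (hA : ¬ G.ColorableOn A (4 * q)) :
    ∃ (u v : V) (p : G.Walk u v), p.IsPath ∧ (∀ x ∈ p.support, x ∈ A) ∧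
      (q : ℝ) ^ ((r : ℝ) / ((r : ℝ) - 1)) / 12 ≤ p.length + 1 := by
  have hs4 : 4 ≤ Nat.sqrt q := Nat.le_sqrt.2 (by omega)
  have hsq : Nat.sqrt q * Nat.sqrt q ≤ q := Nat.sqrt_le q
  have hlt : q < (Nat.sqrt q + 1) * (Nat.sqrt q + 1) := Nat.lt_succ_sqrt q
  have hsle : Nat.sqrt q ≤ q := Nat.sqrt_le_self q
  generalize Nat.sqrt q = s at *
  obtain ⟨H, hHA, hH, hHc⟩ := exists_linkedOn_of_not_colorableOn (s := s) (c := 2 * q) (by omega)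
    (fun h => hA (h.mono subset_rfl (by rw [sq]; omega)))
  obtain ⟨u, v, p, hp, hpH, hor⟩ := hH.exists_long_path (by omega) (by omega) hHc
  refine ⟨u, v, p, hp, fun x hx => hHA (hpH x hx), ?_⟩
  have hqR : (16 : ℝ) ≤ q := by exact_mod_cast hq
  rcases hor with h | h
  · have h1 := rpow_le_card_of_not_colorableOn (by omega) hcl (by omega) h
    rw [List.toFinset_card_of_nodup hp.support_nodup, Walk.length_support,
      Real.div_rpow (by positivity) (by norm_num)] at h1
    push_cast at h1
    have h3 : (3 : ℝ) ^ ((r : ℝ) / ((r : ℝ) - 1)) ≤ 6 := by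
      refine (rpow_le_mul_sqrt hr (by norm_num)).trans ?_
      have : √(3 : ℝ) ≤ 2 := Real.sqrt_le_iff.2 (by norm_num)
      linarith
    have h4 : (0 : ℝ) < (3 : ℝ) ^ ((r : ℝ) / ((r : ℝ) - 1)) := by positivity
    refine le_trans ?_ h1
    rw [div_div]
    gcongr
    linarith
  · have h1 : ((s : ℝ) - 1) * (q / 2) ≤ p.length := by
      have e1 : (((s - 1) * ((q + 1) / 2) : ℕ) : ℝ) ≤ p.length := by exact_mod_cast h
      refine le_trans ?_ e1
      rw [Nat.cast_mul, Nat.cast_sub (by omega), Nat.cast_one]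
      have e2 : (q : ℝ) / 2 ≤ ((q + 1) / 2 : ℕ) := by
        have : (q : ℝ) ≤ ((2 * ((q + 1) / 2) : ℕ) : ℝ) := by exact_mod_cast (by omega)
        push_cast at this ⊢
        linarith
      have e3 : (4 : ℝ) ≤ s := by exact_mod_cast hs4
      exact mul_le_mul_of_nonneg_left e2 (by linarith)
    have hsR : (4 : ℝ) ≤ s := by exact_mod_cast hs4
    have h2 : √(q : ℝ) ≤ s + 1 := by
      rw [Real.sqrt_le_iff]
      refine ⟨by positivity, ?_⟩
      rw [sq]
      exact_mod_cast hlt.le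
    have h3 : (q : ℝ) * √q ≤ q * (s + 1) := by gcongr
    have h4 := rpow_le_mul_sqrt hr (show (1 : ℝ) ≤ q by linarith)
    nlinarith

/-! ### Breadth-first layers and cycles of consecutive lengths -/

theorem exists_parent (v₀ : V) :
    ∃ par : V → V, ∀ x, G.Reachable v₀ x → G.dist v₀ x ≠ 0 →
      G.Adj x (par x) ∧ G.Reachable v₀ (par x) ∧ G.dist v₀ (par x) + 1 = G.dist v₀ x := by
  have : ∀ x, ∃ y, G.Reachable v₀ x → G.dist v₀ x ≠ 0 →
      G.Adj x y ∧ G.Reachable v₀ y ∧ G.dist v₀ y + 1 = G.dist v₀ x := by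
    intro x
    by_cases hx : G.Reachable v₀ x ∧ G.dist v₀ x ≠ 0
    swap
    · exact ⟨x, fun h1 h2 => (hx ⟨h1, h2⟩).elim⟩
    obtain ⟨hx, hx0⟩ := hx
    obtain ⟨p, hp⟩ := hx.symm.exists_walk_length_eq_dist
    rw [dist_comm] at hp
    cases p with
    | nil => simp at hx0
    | @cons _ y _ hadj p =>
      refine ⟨y, fun _ _ => ⟨hadj, p.reachable.symm, ?_⟩⟩
      rw [Walk.length_cons] at hp
      have h1 := dist_le p
      rw [dist_comm] at h1
      obtain ⟨q, hq⟩ := p.reachable.symm.exists_walk_length_eq_dist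
      have h2 := dist_le (q.concat hadj.symm)
      rw [Walk.length_concat] at h2
      omega
  choose par hpar using this
  exact ⟨par, hpar⟩

theorem dist_iterate_parent {v₀ : V} {par : V → V}
    (hpar : ∀ x, G.Reachable v₀ x → G.dist v₀ x ≠ 0 →
      G.Adj x (par x) ∧ G.Reachable v₀ (par x) ∧ G.dist v₀ (par x) + 1 = G.dist v₀ x)
    (j : ℕ) {x : V} (hx : G.Reachable v₀ x) (hj : j ≤ G.dist v₀ x) :
    G.Reachable v₀ (par^[j] x) ∧ G.dist v₀ (par^[j] x) + j = G.dist v₀ x := by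
  induction j generalizing x with
  | zero => exact ⟨hx, rfl⟩
  | succ j ih =>
    obtain ⟨-, hr, hd⟩ := hpar x hx (by omega)
    obtain ⟨h1, h2⟩ := ih hr (by omega)
    rw [Function.iterate_succ_apply]
    exact ⟨h1, by omega⟩

theorem exists_path_iterate_parent {v₀ : V} {par : V → V}
    (hpar : ∀ x, G.Reachable v₀ x → G.dist v₀ x ≠ 0 →
      G.Adj x (par x) ∧ G.Reachable v₀ (par x) ∧ G.dist v₀ (par x) + 1 = G.dist v₀ x)
    (j : ℕ) {x : V} (hx : G.Reachable v₀ x) (hj : j ≤ G.dist v₀ x) :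
    ∃ t : G.Walk x (par^[j] x), t.IsPath ∧ t.length = j ∧
      ∀ y ∈ t.support, ∃ k ≤ j, par^[k] x = y := by
  induction j generalizing x with
  | zero => exact ⟨Walk.nil, Walk.IsPath.nil, rfl, by simp⟩
  | succ j ih =>
    obtain ⟨hadj, hr, hd⟩ := hpar x hx (by omega)
    obtain ⟨t, ht, htl, hts⟩ := ih hr (by omega)
    rw [Function.iterate_succ_apply]
    refine ⟨Walk.cons hadj t, ht.cons fun hxt => ?_, by rw [Walk.length_cons, htl],
      fun y hy => ?_⟩
    · obtain ⟨k, hk, hkx⟩ := hts x hxt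
      have := (dist_iterate_parent hpar k hr (by omega)).2
      rw [hkx] at this
      omega
    · rw [Walk.support_cons, List.mem_cons] at hy
      rcases hy with rfl | hy
      · exact ⟨0, by omega, rfl⟩
      · obtain ⟨k, hk, rfl⟩ := hts y hy
        exact ⟨k + 1, by omega, rfl⟩

/-- A set of vertices at the same distance from a root splits into two parts such that any two
vertices from different parts are joined by paths of a fixed length outside the set. -/
theorem exists_split_of_dist_eq {v₀ : V} {D : Finset V} {i : ℕ}
    (hD : ∀ x ∈ D, G.Reachable v₀ x ∧ G.dist v₀ x = i) (hcard : 2 ≤ D.card) :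
    ∃ (A B : Finset V) (j : ℕ), A ∪ B = D ∧ Disjoint A B ∧ A.Nonempty ∧ B.Nonempty ∧ 1 ≤ j ∧
      ∀ a ∈ A, ∀ b ∈ B, ∃ t : G.Walk a b, t.IsPath ∧ t.length = 2 * j ∧
        ∀ x ∈ t.support, x ∈ D → x = a ∨ x = b := by
  obtain ⟨par, hpar⟩ := G.exists_parent v₀
  let P : ℕ → Prop := fun j => ∀ x ∈ D, ∀ y ∈ D, par^[j] x = par^[j] y
  have hroot : ∀ x ∈ D, v₀ = par^[i] x := fun x hx => by
    obtain ⟨h1, h2⟩ := dist_iterate_parent hpar i (hD x hx).1 (hD x hx).2.ge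
    rw [(hD x hx).2] at h2
    exact h1.dist_eq_zero_iff.1 (by omega)
  have hPi : P i := fun x hx y hy => (hroot x hx).symm.trans (hroot y hy)
  have hex : ∃ j, P j := ⟨i, hPi⟩
  -- The least height at which all of `D` has a common ancestor. At height `j - 1` there are
  -- several, and `A` collects the vertices below one of them.
  set j := Nat.find hex with hj
  have hPj : P j := Nat.find_spec hex
  have hji : j ≤ i := Nat.find_min' hex hPi
  have hj1 : 1 ≤ j := by
    by_contra h0
    have h0' : j = 0 := by omega
    rw [h0'] at hPj
    obtain ⟨x, hx, y, hy, hxy⟩ := Finset.one_lt_card.1 (show 1 < D.card by omega)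
    exact hxy (hPj x hx y hy)
  have hnP : ¬ P (j - 1) := Nat.find_min hex (show j - 1 < Nat.find hex by omega)
  simp only [P] at hnP
  push Not at hnP
  obtain ⟨x₀, hx₀, y₀, hy₀, hxy₀⟩ := hnP
  set A := D.filter (fun x => par^[j - 1] x = par^[j - 1] x₀) with hA
  have hAD : A ⊆ D := Finset.filter_subset _ _
  refine ⟨A, D \ A, j, Finset.union_sdiff_of_subset hAD, Finset.disjoint_sdiff,
    ⟨x₀, Finset.mem_filter.2 ⟨hx₀, rfl⟩⟩,
    ⟨y₀, Finset.mem_sdiff.2 ⟨hy₀, fun h => hxy₀ (Finset.mem_filter.1 h).2.symm⟩⟩, hj1, ?_⟩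
  intro a ha b hb
  obtain ⟨haD, ha'⟩ := Finset.mem_filter.1 ha
  obtain ⟨hbD, hbA⟩ := Finset.mem_sdiff.1 hb
  have hne : par^[j - 1] a ≠ par^[j - 1] b := fun h =>
    hbA (Finset.mem_filter.2 ⟨hbD, h.symm.trans ha'⟩)
  obtain ⟨hra, hda⟩ := hD a haD
  obtain ⟨hrb, hdb⟩ := hD b hbD
  obtain ⟨t, ht, htl, hts⟩ := exists_path_iterate_parent hpar j hra (by omega)
  have hu := exists_path_iterate_parent hpar j hrb (by omega)
  rw [hPj b hbD a haD] at hu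
  obtain ⟨u, hu, hul, hus⟩ := hu
  have hlev : ∀ x ∈ D, ∀ k ≤ j, G.dist v₀ (par^[k] x) + k = i := fun x hx k hk => by
    obtain ⟨h1, h2⟩ := hD x hx
    rw [← h2]
    exact (dist_iterate_parent hpar k h1 (by omega)).2
  refine ⟨t.append u.reverse, ht.append_of_meet hu.reverse fun x hx hx' => ?_, ?_,
    fun x hx hxD => ?_⟩
  · rw [Walk.support_reverse, List.mem_reverse] at hx'
    obtain ⟨k, hk, rfl⟩ := hts x hx
    obtain ⟨l, hl, hlk⟩ := hus _ hx'
    have h1 := hlev a haD k hk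
    have h2 := hlev b hbD l hl
    rw [hlk] at h2
    have hkl : l = k := by omega
    subst hkl
    by_cases hkj : l = j
    · rw [hkj]
    -- Branches meeting below height `j` would coincide from there on, in particular at height `j -
    -- 1`.
    · refine (hne ?_).elim
      have : j - 1 = (j - 1 - l) + l := by omega
      rw [this, Function.iterate_add_apply, Function.iterate_add_apply, hlk]
  · rw [Walk.length_append, Walk.length_reverse, htl, hul, two_mul]
  · have hlast := (hD x hxD).2
    rw [Walk.mem_support_append_iff, Walk.support_reverse, List.mem_reverse] at hx
    rcases hx with hx | hx
    · obtain ⟨k, hk, rfl⟩ := hts x hx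
      have := hlev a haD k hk
      have hk0 : k = 0 := by omega
      subst hk0
      exact Or.inl rfl
    · obtain ⟨k, hk, rfl⟩ := hus x hx
      have := hlev b hbD k hk
      have hk0 : k = 0 := by omega
      subst hk0
      exact Or.inr rfl

/-- Some distance layer carries at least half of the chromatic number. -/
theorem exists_layer_not_colorableOn (v₀ : V) {W : Finset V} {n : ℕ}
    (hW : ¬ G.ColorableOn W (2 * n)) :
    ∃ i, ¬ G.ColorableOn (W.filter (fun x => G.dist v₀ x = i)) n := by
  by_contra! hcon
  choose c hc hp using hcon
  -- Two palettes of `n` colours, chosen by the parity of the layer.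
  refine hW ⟨fun x => (G.dist v₀ x % 2) * n + c (G.dist v₀ x) x, fun x hx => ?_,
    fun x hx y hy hxy => ?_⟩
  · have h1 := hc _ x (Finset.mem_filter.2 ⟨hx, rfl⟩)
    rcases Nat.mod_two_eq_zero_or_one (G.dist v₀ x) with h | h <;> dsimp only <;> rw [h] <;> omega
  · have h1 := hc _ x (Finset.mem_filter.2 ⟨hx, rfl⟩)
    have h2 := hc _ y (Finset.mem_filter.2 ⟨hy, rfl⟩)
    dsimp only
    by_cases hd : G.dist v₀ x = G.dist v₀ y
    · have := hp (G.dist v₀ y) x (Finset.mem_filter.2 ⟨hx, hd⟩) y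
        (Finset.mem_filter.2 ⟨hy, rfl⟩) hxy
      rw [hd]
      omega
    · have h3 := hxy.diff_dist_adj (u := v₀)
      have h4 : (G.dist v₀ x % 2 = 0 ∧ G.dist v₀ y % 2 = 1) ∨
          (G.dist v₀ x % 2 = 1 ∧ G.dist v₀ y % 2 = 0) := by omega
      rcases h4 with ⟨h, h'⟩ | ⟨h, h'⟩ <;> rw [h, h'] <;> omega

/-- A path inside one part of a connected set, reached from the other part and followed along its
longer half. -/
theorem CriticalOn.exists_path_from {D A B : Finset V} {n : ℕ} (hD : G.CriticalOn D n)
    (hAB : A ∪ B = D) (hdisj : Disjoint A B) (hB : B.Nonempty) {u v : V} {p : G.Walk u v}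
    (hp : p.IsPath) (hpA : ∀ x ∈ p.support, x ∈ A) :
    ∃ (b x : V) (w : G.Walk b x), w.IsPath ∧ b ∈ B ∧ (∀ y ∈ w.support, y ∈ D) ∧
      (∀ y ∈ w.support, y ∈ B → y = b) ∧ p.length + 1 ≤ 2 * w.length := by
  obtain ⟨b₀, hb₀⟩ := hB
  have hAD : A ⊆ D := hAB ▸ Finset.subset_union_left
  have hBD : B ⊆ D := hAB ▸ Finset.subset_union_right
  obtain ⟨w₀, hw₀⟩ := hD.exists_walk (hBD hb₀) (hAD (hpA u p.start_mem_support))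
  obtain ⟨b, x, q, hb, hx, hq, hqw, hqB, hqp⟩ := w₀.exists_path_between hb₀
    (Y := p.support.toFinset) (List.mem_toFinset.2 p.start_mem_support)
  have hpB : ∀ y ∈ p.support, y ∉ B := fun y hy => Finset.disjoint_left.1 hdisj (hpA y hy)
  have hql : 1 ≤ q.length := by
    by_contra h0
    have := Walk.eq_of_length_eq_zero (p := q) (by omega)
    exact hpB x (List.mem_toFinset.1 hx) (this ▸ hb)
  obtain ⟨m, hm, hml⟩ := Walk.mem_support_iff_exists_getVert.1 (List.mem_toFinset.1 hx)
  obtain ⟨⟨t, ht, htl, hts⟩, ⟨d, hd, hdl, hds⟩⟩ := hp.exists_split hml hm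
  obtain ⟨y, r, hr, hrl, hrp⟩ : ∃ (y : V) (r : G.Walk x y), r.IsPath ∧ p.length ≤ 2 * r.length ∧
      ∀ z ∈ r.support, z ∈ p.support := by
    rcases le_total (p.length - m) m with h | h
    · refine ⟨_, t.reverse, ht.reverse, by rw [Walk.length_reverse]; omega, fun z hz => ?_⟩
      rw [Walk.support_reverse, List.mem_reverse] at hz
      obtain ⟨k, -, rfl⟩ := hts z hz
      exact p.getVert_mem_support k
    · refine ⟨_, d, hd, by omega, fun z hz => ?_⟩
      obtain ⟨k, -, -, rfl⟩ := hds z hz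
      exact p.getVert_mem_support k
  refine ⟨b, y, q.append r, hq.append_of_meet hr fun z hz hz' =>
    hqp z hz (List.mem_toFinset.2 (hrp z hz')), hb, fun z hz => ?_, fun z hz hzB => ?_, ?_⟩
  · rw [Walk.mem_support_append_iff] at hz
    exact hz.elim (fun h => hw₀ z (hqw z h)) (fun h => hAD (hpA z (hrp z h)))
  · rw [Walk.mem_support_append_iff] at hz
    exact hz.elim (fun h => hqB z h hzB) (fun h => (hpB z (hrp z h) hzB).elim)
  · rw [Walk.length_append]; omega

/-- Every vertex of `w` other than `b` lies in `A`, so each initial segment with `i + 1` edges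
closes up to a cycle of length `2 * j + 1 + i`. -/
theorem hasCyclesOfConsecutiveLengths_of_path {D A B : Finset V} (hAB : A ∪ B = D) {j : ℕ}
    (hj : 1 ≤ j)
    (hjoin : ∀ a ∈ A, ∀ b ∈ B, ∃ t : G.Walk a b, t.IsPath ∧ t.length = 2 * j ∧
      ∀ x ∈ t.support, x ∈ D → x = a ∨ x = b)
    {b x : V} {w : G.Walk b x} (hw : w.IsPath) (hb : b ∈ B) (hwD : ∀ y ∈ w.support, y ∈ D)
    (hwB : ∀ y ∈ w.support, y ∈ B → y = b) :
    G.HasCyclesOfConsecutiveLengths w.length := by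
  refine ⟨2 * j + 1, fun i hi => ?_⟩
  obtain ⟨⟨p, hp, hpl, hps⟩, -⟩ := hw.exists_split (m := i + 1) (by omega) rfl
  have hpw : ∀ y ∈ p.support, y ∈ w.support := fun y hy => by
    obtain ⟨k, -, rfl⟩ := hps y hy
    exact w.getVert_mem_support k
  have hyb : w.getVert (i + 1) ≠ b := fun h => by
    have := hw.getVert_injOn (show i + 1 ∈ {i | i ≤ w.length} by simp; omega)
      (show 0 ∈ {i | i ≤ w.length} by simp) (h.trans w.getVert_zero.symm)
    omega
  have hyw := w.getVert_mem_support (i + 1)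
  have hyA : w.getVert (i + 1) ∈ A := by
    have := hwD _ hyw
    rw [← hAB, Finset.mem_union] at this
    exact this.resolve_right fun h => hyb (hwB _ hyw h)
  obtain ⟨t, ht, htl, hts⟩ := hjoin _ hyA b hb
  refine ⟨b, p.append t, hp.isCycle_append ht ?_ (Or.inr (by omega)), ?_⟩
  · intro z hz hz'
    have hpn := hp.support_nodup
    have htn := ht.support_nodup
    rw [← Walk.cons_tail_support] at hpn htn
    rcases hts z (List.mem_of_mem_tail hz') (hwD z (hpw z (List.mem_of_mem_tail hz))) with h | h
    · exact (List.nodup_cons.1 htn).1 (h ▸ hz')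
    · exact (List.nodup_cons.1 hpn).1 (h ▸ hz)
  · rw [Walk.length_append, hpl, htl]; omega

/-- The `16 * q` colours are halved twice, by passing to a layer and to one of its two parts, which
leaves the `4 * q` needed for a long path. Keeping its longer half turns `12` into `24`. -/
theorem exists_consecutive_cycles_of_large [Finite V] {r q : ℕ} (hr : 3 ≤ r)
    (hcl : G.CliqueFree (r + 1)) (hq : 16 ≤ q) {W : Finset V}
    (hW : ¬ G.ColorableOn W (16 * q)) :
    ∃ m : ℕ, (q : ℝ) ^ ((r : ℝ) / ((r : ℝ) - 1)) / 24 ≤ m ∧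
      G.HasCyclesOfConsecutiveLengths m := by
  obtain ⟨W', -, hW'⟩ := exists_criticalOn_subset hW
  obtain ⟨v₀, hv₀⟩ := hW'.nonempty
  obtain ⟨i, hi⟩ := exists_layer_not_colorableOn (n := 8 * q) v₀
    (fun h => hW'.1 (h.mono subset_rfl (by omega)))
  obtain ⟨D, hDsub, hD⟩ := exists_criticalOn_subset hi
  have hDr : ∀ x ∈ D, G.Reachable v₀ x ∧ G.dist v₀ x = i := fun x hx => by
    obtain ⟨h1, h2⟩ := Finset.mem_filter.1 (hDsub hx)
    obtain ⟨p, -⟩ := hW'.exists_walk hv₀ h1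
    exact ⟨p.reachable, h2⟩
  have hDc : 2 ≤ D.card := by
    by_contra hlt
    exact hD.1 ((colorableOn_card D).mono subset_rfl (by omega))
  obtain ⟨A, B, j, hAB, hdisj, hA, hB, hj, hjoin⟩ := exists_split_of_dist_eq hDr hDc
  have key : ∀ A B : Finset V, A ∪ B = D → Disjoint A B → B.Nonempty →
      (∀ a ∈ A, ∀ b ∈ B, ∃ t : G.Walk a b, t.IsPath ∧ t.length = 2 * j ∧
        ∀ x ∈ t.support, x ∈ D → x = a ∨ x = b) → ¬ G.ColorableOn A (4 * q) →
      ∃ m : ℕ, (q : ℝ) ^ ((r : ℝ) / ((r : ℝ) - 1)) / 24 ≤ m ∧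
        G.HasCyclesOfConsecutiveLengths m := by
    intro A B hAB hdisj hB hjoin hAc
    obtain ⟨u, v, p, hp, hpA, hpl⟩ := exists_long_path_of_cliqueFree hr hcl hq hAc
    obtain ⟨b, x, w, hw, hb, hwD, hwB, hwl⟩ := hD.exists_path_from hAB hdisj hB hp hpA
    refine ⟨w.length, ?_, hasCyclesOfConsecutiveLengths_of_path hAB hj hjoin hw hb hwD hwB⟩
    have : (p.length : ℝ) + 1 ≤ 2 * w.length := by exact_mod_cast hwl
    linarith
  by_cases hAc : G.ColorableOn A (4 * q)
  · refine key B A (by rw [Finset.union_comm, hAB]) hdisj.symm hA (fun b hb a ha => ?_)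
      (fun hBc => ?_)
    · obtain ⟨t, ht, htl, hts⟩ := hjoin a ha b hb
      exact ⟨t.reverse, ht.reverse, by rw [Walk.length_reverse, htl], fun x hx hxD =>
        (hts x (by simpa using hx) hxD).symm⟩
    · have := hAc.union hBc
      rw [hAB] at this
      exact hD.1 (this.mono subset_rfl (by omega))
  · exact key A B hAB hdisj hB hjoin hAc

/-! ### The absolute constant -/

theorem exists_consecutive_cycles [Finite V] {r k : ℕ} (hr : 3 ≤ r) (hk : 3 ≤ k)
    (hcl : G.CliqueFree (r + 1)) (hchi : G.chromaticNumber = (k : ℕ∞)) :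
    ∃ m : ℕ, 1 / 10000 * (k : ℝ) ^ ((r : ℝ) / ((r : ℝ) - 1)) ≤ m ∧ 1 ≤ m ∧
      G.HasCyclesOfConsecutiveLengths m := by
  have := Fintype.ofFinite V
  have hnot : ¬ G.ColorableOn Finset.univ (k - 1) := fun h => by
    have h1 := (colorableOn_univ_iff.1 h).chromaticNumber_le
    rw [hchi] at h1
    have h2 : k ≤ k - 1 := by exact_mod_cast h1
    omega
  have hkR : (1 : ℝ) ≤ k := by exact_mod_cast (by omega : 1 ≤ k)
  have hr' : (3 : ℝ) ≤ r := by exact_mod_cast hr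
  have hexp : 0 ≤ (r : ℝ) / ((r : ℝ) - 1) := div_nonneg (by linarith) (by linarith)
  by_cases hsmall : k < 300
  -- For small `k` a single cycle suffices, as `300 * √300 ≤ 5400 < 10000`.
  · obtain ⟨M, -, hM⟩ := exists_criticalOn_subset hnot
    obtain ⟨v, c, hc, -, -⟩ := exists_cycle_of_le_degree hM.nonempty (by omega)
      (fun v hv => hM.le_card_filter_adj hv)
    refine ⟨1, ?_, le_rfl, c.length, fun i hi => ⟨v, c, hc, by omega⟩⟩
    have h1 : (k : ℝ) ^ ((r : ℝ) / ((r : ℝ) - 1)) ≤ (300 : ℝ) ^ ((r : ℝ) / ((r : ℝ) - 1)) :=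
      Real.rpow_le_rpow (by positivity) (by exact_mod_cast hsmall.le) hexp
    have h2 := h1.trans (rpow_le_mul_sqrt hr (by norm_num))
    have h3 : √(300 : ℝ) ≤ 18 := Real.sqrt_le_iff.2 (by norm_num)
    rw [Nat.cast_one]
    linarith
  · have hq16 : 16 ≤ (k - 1) / 16 := by omega
    obtain ⟨m, hm, hcyc⟩ := exists_consecutive_cycles_of_large (q := (k - 1) / 16) hr hcl hq16
      (fun h => hnot (h.mono subset_rfl (by omega)))
    -- The rounding in `(k - 1) / 16` loses at most a factor `2`; with `32 ^ (r / (r - 1)) ≤ 192`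
    -- the constant is `24 * 192 = 4608 < 10000`.
    have hqk : (k : ℝ) / 32 ≤ ((k - 1) / 16 : ℕ) := by
      have h1 : k ≤ 32 * ((k - 1) / 16) := by omega
      have h2 : (k : ℝ) ≤ 32 * ((k - 1) / 16 : ℕ) := by exact_mod_cast h1
      linarith
    have h1 : ((k : ℝ) / 32) ^ ((r : ℝ) / ((r : ℝ) - 1)) ≤
        (((k - 1) / 16 : ℕ) : ℝ) ^ ((r : ℝ) / ((r : ℝ) - 1)) :=
      Real.rpow_le_rpow (by positivity) hqk hexp
    rw [Real.div_rpow (by positivity) (by norm_num)] at h1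
    have h32 : (32 : ℝ) ^ ((r : ℝ) / ((r : ℝ) - 1)) ≤ 192 := by
      refine (rpow_le_mul_sqrt hr (by norm_num)).trans ?_
      have : √(32 : ℝ) ≤ 6 := Real.sqrt_le_iff.2 (by norm_num)
      linarith
    have hpos : (0 : ℝ) < (k : ℝ) ^ ((r : ℝ) / ((r : ℝ) - 1)) := by positivity
    have h2 : (k : ℝ) ^ ((r : ℝ) / ((r : ℝ) - 1)) / 192 ≤
        (k : ℝ) ^ ((r : ℝ) / ((r : ℝ) - 1)) / 32 ^ ((r : ℝ) / ((r : ℝ) - 1)) := by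
      gcongr
    refine ⟨m, by linarith, ?_, hcyc⟩
    have : (0 : ℝ) < m := by linarith
    exact_mod_cast this

end SimpleGraph

theorem theorem3 :
    ∃ c : ℝ, 0 < c ∧
      ∀ (r k : ℕ), 3 ≤ r → 3 ≤ k →
        ∀ (V : Type*) [Finite V] (G : SimpleGraph V),
          G.chromaticNumber = (k : ℕ∞) → G.CliqueFree (r + 1) →
            (∃ l : ℕ, c * (k : ℝ) ^ ((r : ℝ) / ((r : ℝ) - 1)) ≤ (l : ℝ) ∧
              G.HasCycleOfLength l) ∧
            (∃ m : ℕ, c * (k : ℝ) ^ ((r : ℝ) / ((r : ℝ) - 1)) ≤ (m : ℝ) ∧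
              G.HasCyclesOfConsecutiveLengths m) := by
  refine ⟨1 / 10000, by norm_num, fun r k hr hk V _ G hchi hcl => ?_⟩
  obtain ⟨m, hm, hm1, a, ha⟩ := SimpleGraph.exists_consecutive_cycles hr hk hcl hchi
  -- The longest of the `m` cycles is the required long cycle: its length is at least `m` because
  -- the shortest has length `a ≥ 3`.
  refine ⟨⟨a + (m - 1), hm.trans ?_, ha (m - 1) (by omega)⟩, m, hm, a, ha⟩
  obtain ⟨v, p, hp, hpl⟩ := ha 0 (by omega)
  have := hp.three_le_length
  exact_mod_cast (by omega : m ≤ a + (m - 1))
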